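/- **Theorem (Tableau formula for vexillary determinants).** Let $\tau=(p_\bullet,q_\bullet)$ be a complete triple of length $n$: integers (possibly negative) $p_1\le\dots\le p_n$ and $q_1\ge\dots\ge q_n$ such that $\lambda_i:=q_i-p_i+i$ satisfies $\lambda_1\ge\dots\ge\lambda_n>0$. Let $x_i,y_i$ ($i\in\mathbb Z$) be elements of a commutative ring (for instance independent variables), and put $\tilde x_i=-x_{1-i}$, $\tilde y_i=-y_{1-i}$ for $i\ge1$. Let $$a(i)=\frac{\prod_{j=p_i+1}^{0}(1-x_jt)\,\prod_{j=1}^{q_i}(1+y_jt)}{\prod_{j=1}^{p_i}(1-x_jt)\,\prod_{j=q_i+1}^{0}(1+y_jt)},\qquad S_{\lambda/\mu}(a(\bullet))=\det\bigl(a(k)_{\lambda_k-\mu_l+l-k}\bigr)_{1\le k,l\le n},$$ where $f_m$ is the coefficient of $t^m$ in $f$ (zero for $m<0$) and empty products are $1$. For a power series $c=1+c_1t+c_2t^2+\cdots$ let $S_\mu(c)=\det(c_{\mu_k+l-k})_{1\le k,l\le n}$, and let $P_\tau(c,x,y)=\det\bigl((a(k)\,c)_{\lambda_k+l-k}\bigr)_{1\le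 k,l\le n}$ be the vexillary enriched Schubert polynomial. *Divisions.* A division of $\tau$ consists of integers $0\le r<s\le n+1$ such that $p_i\le0\le q_i$ for $i\le r$, $q_i\le0\le p_i$ for $i\ge s$, and either (1) $p_i,q_i\ge0$ for all $r<i<s$, or (2) $p_i,q_i\le0$ for all $r<i<s$, together with a choice of a case, (1) or (2), that holds. Given a division, define nonnegative flags $(P_i,Q_i)$ to be $(0,\,q_i-p_i)$ for $i\le r$; $(p_i-q_i,\,0)$ for $i\ge s$; and for $r<i<s$, $(p_i,q_i)$ in case (1) and $(-q_i,-p_i)$ in case (2). *Tableaux.* For weakly decreasing integers $\mu_1\ge\dots\ge\mu_n$ with $\mu_i\le\lambda_i$, a tableau on $\lambda/\mu$ is a filling of the boxes $(i,j)$, $1\le i\le n$, $\mu_i<j\le\lambda_i$, each box containing a plain integer $k$, a primed integer $l'$, or a pair $(k,l')$, such that: - in row $i$, every $k$ satisfies $1\le k\le P_i$ and every $l'$ satisfies $1\le l\le Q_i$; - a box immediately right of or below a box containing a plain (resp. primed) entry contains a plain (resp. primed) entry; plain entries increase weakly along rows and strictly down columns; primed entries increase strictly along rows and weakly down columns; -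 the entry immediately right of a pair $(k,l')$ is $(k+m,(l+m+1)')$, and the entry immediately below it is $(k+m+1,(l+m)')$, for some $m\ge0$; - in box $(i,j)$, a pair $(k,l')$ has $l-k=j-i$, a lone plain $k$ has $k\le i-j$, and a lone primed $l'$ has $l\le j-i$. *Weights.* Give $k$, $l'$, $(k,l')$ the weights $u_k$, $v_l$, $u_k+v_l$, and a tableau the product of the weights of its entries, where $u$ and $v$ are specialized as follows. In case (1), the sequence $v_1,v_2,\dots$ is $y_1,\dots,y_{q_r},\ \tilde x_1,\dots,\tilde x_{-p_r},\ y_{q_r+1},\dots,y_{q_{r-1}},\ \tilde x_{-p_r+1},\dots,\tilde x_{-p_{r-1}},\ \dots$, through row $1$ (all $q_1-p_1$ variables), and $u_1,u_2,\dots$ is $x_1,\dots,x_{p_s},\ \tilde y_1,\dots,\tilde y_{-q_s},\ x_{p_s+1},\dots,x_{p_{s+1}},\ \tilde y_{-q_s+1},\dots,\tilde y_{-q_{s+1}},\ \dots$, through row $n$ (all $p_n-q_n$ variables); if $r=0$ then $v_l=y_l$ for all $l$, and if $s=n+1$ then $u_k=x_k$ for all $k$. In case (2) the roles are interchanged: each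 block of $\tilde x$'s precedes the corresponding block of $y$'s, each block of $\tilde y$'s precedes the corresponding block of $x$'s, and $v_l=\tilde x_l$ if $r=0$, $u_k=\tilde y_k$ if $s=n+1$. Then $\tau$ has a division, and for every division and every weakly decreasing integer sequence $\mu$ with $\mu_i\le\lambda_i$, $$S_{\lambda/\mu}(a(\bullet))=\sum_{T}\operatorname{wt}(T),$$ the sum over all tableaux $T$ on $\lambda/\mu$. The right side is a polynomial with nonnegative integer coefficients in the $x_i,y_i,\tilde x_i,\tilde y_i$, $i\ge1$. Consequently $$P_\tau(c,x,y)=\sum_{\mu\subset\lambda}\Bigl(\sum_{T\text{ on }\lambda/\mu}\operatorname{wt}(T)\Bigr)S_\mu(c),$$ the outer sum over all partitions $\mu\subset\lambda$. -/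

import Mathlib

namespace Vexillary

/-- A complete triple of length `n`: integer sequences `p` (weakly increasing) and `q` (weakly
decreasing), with `k_i = i`, such that the numbers `l_i = q_i - p_i + i` are weakly decreasing and
positive.  Rows are numbered from `1` to `n`; row number `i` is the element of `Fin n` with
value `i - 1`. -/
structure CompleteTriple (n : ℕ) where
  p : Fin n → ℤ
  q : Fin n → ℤ
  p_mono : Monotone p
  q_anti : Antitone q
  l_anti : Antitone fun i : Fin n => q i - p i + ((i : ℤ) + 1)
  l_pos : ∀ i : Fin n, 0 < q i - p i + ((i : ℤ) + 1)

/-- The partition of a complete triple: `λ_i = q_i - p_i + i`. -/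
def CompleteTriple.shape {n : ℕ} (τ : CompleteTriple n) (i : Fin n) : ℤ :=
  τ.q i - τ.p i + ((i : ℤ) + 1)

section Determinants

variable {R : Type*} [CommRing R]

/-- The coefficient of `t ^ m` for `m : ℤ`; it is zero for negative `m`. -/
noncomputable def intCoeff (f : PowerSeries R) (m : ℤ) : R :=
  if 0 ≤ m then PowerSeries.coeff m.toNat f else 0

/-- `S_{λ/μ}(f(1), …, f(n)) = det (f(k)_{λ_k - μ_l + l - k})`. -/
noncomputable def skewSchur {n : ℕ} (f : Fin n → PowerSeries R) (lam mu : Fin n → ℤ) : R :=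
  Matrix.det (Matrix.of fun k l : Fin n => intCoeff (f k) (lam k - mu l + (l : ℤ) - (k : ℤ)))

/-- `S_λ(f(1), …, f(n))`. -/
noncomputable def schur {n : ℕ} (f : Fin n → PowerSeries R) (lam : Fin n → ℤ) : R :=
  skewSchur f lam 0

/-- The numerator of `a(p, q)`: `∏_{i=p+1}^0 (1 - x_i t) * ∏_{j=1}^q (1 + y_j t)`. -/
noncomputable def chernNum (x y : ℤ → R) (p q : ℤ) : PowerSeries R :=
  (∏ i ∈ Finset.Icc (p + 1) 0, (1 - PowerSeries.C (x i) * PowerSeries.X)) *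
    ∏ j ∈ Finset.Icc 1 q, (1 + PowerSeries.C (y j) * PowerSeries.X)

/-- The denominator of `a(p, q)`: `∏_{i=1}^p (1 - x_i t) * ∏_{j=q+1}^0 (1 + y_j t)`. -/
noncomputable def chernDen (x y : ℤ → R) (p q : ℤ) : PowerSeries R :=
  (∏ i ∈ Finset.Icc 1 p, (1 - PowerSeries.C (x i) * PowerSeries.X)) *
    ∏ j ∈ Finset.Icc (q + 1) 0, (1 + PowerSeries.C (y j) * PowerSeries.X)

/-- The Chern series `a(p, q)`; the denominator has constant coefficient `1`, so `invOfUnit _ 1`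
is its inverse. -/
noncomputable def chernSeries (x y : ℤ → R) (p q : ℤ) : PowerSeries R :=
  chernNum x y p q * PowerSeries.invOfUnit (chernDen x y p q) 1

/-- The Chern series `a(i) = a(p_i, q_i)` of a complete triple. -/
noncomputable def CompleteTriple.chern {n : ℕ} (τ : CompleteTriple n) (x y : ℤ → R) (i : Fin n) :
    PowerSeries R :=
  chernSeries x y (τ.p i) (τ.q i)

/-- The vexillary enriched Schubert polynomial `P_τ(c, x, y) = S_λ(a(1) c, …, a(n) c)`. -/
noncomputable def CompleteTriple.enriched {n : ℕ} (τ : CompleteTriple n) (c : PowerSeries R)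
    (x y : ℤ → R) : R :=
  schur (fun i => τ.chern x y i * c) τ.shape

end Determinants

/-- The variables `x_k`, `y_k`, `x̃_k = -x_{1-k}`, `ỹ_k = -y_{1-k}`, for `k ≥ 1`. -/
inductive Letter where
  | x (k : ℕ)
  | y (k : ℕ)
  | xt (k : ℕ)
  | yt (k : ℕ)
  deriving DecidableEq

/-- The values of the letters, given the values of `x_i` and `y_j` for `i, j : ℤ`. -/
def letterValue {R : Type*} [CommRing R] (x y : ℤ → R) : Letter → R
  | .x k => x k
  | .y k => y k
  | .xt k => -x (1 - k)
  | .yt k => -y (1 - k)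

/-- The two cases for the middle rows `r < i < s`: all `p_i, q_i ≥ 0`, or all `p_i, q_i ≤ 0`. -/
inductive MiddleCase where
  | nonneg
  | nonpos
  deriving DecidableEq

/-- A division of the rows `1, …, n` into the rows `i ≤ r`, where `p_i ≤ 0 ≤ q_i`, the rows
`r < i < s`, where `p_i` and `q_i` are all nonnegative or all nonpositive, and the rows `i ≥ s`,
where `q_i ≤ 0 ≤ p_i`. -/
structure CompleteTriple.Division {n : ℕ} (τ : CompleteTriple n) where
  r : ℕ
  s : ℕ
  sign : MiddleCase
  r_lt_s : r < s
  s_le : s ≤ n + 1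
  upper : ∀ i : Fin n, (i : ℕ) + 1 ≤ r → τ.p i ≤ 0 ∧ 0 ≤ τ.q i
  lower : ∀ i : Fin n, s ≤ (i : ℕ) + 1 → 0 ≤ τ.p i ∧ τ.q i ≤ 0
  middle : ∀ i : Fin n, r < (i : ℕ) + 1 → (i : ℕ) + 1 < s →
    match sign with
    | .nonneg => 0 ≤ τ.p i ∧ 0 ≤ τ.q i
    | .nonpos => τ.p i ≤ 0 ∧ τ.q i ≤ 0

/-- For `(m_1, k_1), (m_2, k_2), …` with both coordinates weakly increasing, the word
`A_1 … A_{m_1}  B_1 … B_{k_1}  A_{m_1+1} … A_{m_2}  B_{k_1+1} … B_{k_2}  …`.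
The first two numbers count the letters `A` and `B` that are already in use. -/
def alternating (A B : ℕ → Letter) : ℕ → ℕ → List (ℕ × ℕ) → List Letter
  | _, _, [] => []
  | m, k, (m', k') :: L =>
    (List.range (m' - m)).map (fun t => A (m + t + 1)) ++
      (List.range (k' - k)).map (fun t => B (k + t + 1)) ++ alternating A B m' k' L

namespace CompleteTriple.Division

variable {n : ℕ} {τ : CompleteTriple n} (D : τ.Division)

/-- The upper bound on the plain entries in row `i` of a tableau. -/
def plainFlag (i : Fin n) : ℕ :=
  if (i : ℕ) + 1 ≤ D.r then 0
  else if D.s ≤ (i : ℕ) + 1 then (τ.p i - τ.q i).toNat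
  else match D.sign with
    | .nonneg => (τ.p i).toNat
    | .nonpos => (-τ.q i).toNat

/-- The upper bound on the primed entries in row `i` of a tableau. -/
def primedFlag (i : Fin n) : ℕ :=
  if (i : ℕ) + 1 ≤ D.r then (τ.q i - τ.p i).toNat
  else if D.s ≤ (i : ℕ) + 1 then 0
  else match D.sign with
    | .nonneg => (τ.q i).toNat
    | .nonpos => (-τ.p i).toNat

/-- The rows `r, r - 1, …, 1`, in this order. -/
def upperRows : List (Fin n) :=
  ((List.finRange n).filter fun i : Fin n => (i : ℕ) + 1 ≤ D.r).reverse

/-- The rows `s, s + 1, …, n`, in this order. -/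
def lowerRows : List (Fin n) :=
  (List.finRange n).filter fun i : Fin n => D.s ≤ (i : ℕ) + 1

/-- The letters substituted for `v_1, v_2, …, v_{q_1 - p_1}` by the rows `i ≤ r`. -/
def vWord : List Letter :=
  match D.sign with
  | .nonneg =>
    alternating .y .xt 0 0 (D.upperRows.map fun i => ((τ.q i).toNat, (-τ.p i).toNat))
  | .nonpos =>
    alternating .xt .y 0 0 (D.upperRows.map fun i => ((-τ.p i).toNat, (τ.q i).toNat))

/-- The letters substituted for `u_1, u_2, …, u_{p_n - q_n}` by the rows `i ≥ s`. -/
def uWord : List Letter :=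
  match D.sign with
  | .nonneg =>
    alternating .x .yt 0 0 (D.lowerRows.map fun i => ((τ.p i).toNat, (-τ.q i).toNat))
  | .nonpos =>
    alternating .yt .x 0 0 (D.lowerRows.map fun i => ((-τ.q i).toNat, (τ.p i).toNat))

/-- The letter substituted for `v_l`, `l ≥ 1`.  The default value, for `l` beyond the length of the
word, matters only if `r = 0`, and then it is the letter that the middle rows call for. -/
def vLetter (l : ℕ) : Letter :=
  D.vWord.getD (l - 1) (match D.sign with | .nonneg => .y l | .nonpos => .xt l)

/-- The letter substituted for `u_k`, `k ≥ 1`.  The default value, for `k` beyond the length of the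
word, matters only if `s = n + 1`, and then it is the letter that the middle rows call for. -/
def uLetter (k : ℕ) : Letter :=
  D.uWord.getD (k - 1) (match D.sign with | .nonneg => .x k | .nonpos => .yt k)

end CompleteTriple.Division

/-- An entry of a tableau: a plain integer `k`, a primed integer `l'`, or a pair `(k, l')`. -/
inductive Entry where
  | plain (k : ℕ)
  | primed (l : ℕ)
  | pair (k l : ℕ)
  deriving DecidableEq

/-- The plain integer contained in an entry, if any. -/
def Entry.plain? : Entry → Option ℕ
  | .plain k => some k
  | .primed _ => none
  | .pair k _ => some k

/-- The primed integer contained in an entry, if any. -/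
def Entry.primed? : Entry → Option ℕ
  | .plain _ => none
  | .primed l => some l
  | .pair _ l => some l

/-- The entries with plain integers in `[1, P]` and primed integers in `[1, Q]`. -/
def entries (P Q : ℕ) : Finset Entry :=
  (Finset.Icc 1 P).image .plain ∪ (Finset.Icc 1 Q).image .primed ∪
    (Finset.Icc 1 P ×ˢ Finset.Icc 1 Q).image fun kl => .pair kl.1 kl.2

/-- The boxes of the skew diagram `λ/μ`: pairs of a row `i` and a column `j` with
`μ_i < j ≤ λ_i`. -/
abbrev Box {n : ℕ} (lam mu : Fin n → ℤ) : Type :=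
  (i : Fin n) × {j : ℤ // j ∈ Finset.Ioc (mu i) (lam i)}

/-- The diagonal `j - i` of the box in row `i` and column `j` (rows numbered from `1`). -/
def Box.diag {n : ℕ} {lam mu : Fin n → ℤ} (b : Box lam mu) : ℤ :=
  b.2.1 - ((b.1 : ℤ) + 1)

/-- `b'` is the box immediately to the right of `b`. -/
def Box.IsRightOf {n : ℕ} {lam mu : Fin n → ℤ} (b' b : Box lam mu) : Prop :=
  b'.1 = b.1 ∧ b'.2.1 = b.2.1 + 1

/-- `b'` is the box immediately below `b`. -/
def Box.IsBelow {n : ℕ} {lam mu : Fin n → ℤ} (b' b : Box lam mu) : Prop :=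
  (b'.1 : ℕ) = (b.1 : ℕ) + 1 ∧ b'.2.1 = b.2.1

/-- Compatibility of an entry `e` with the entry `f` to its right: if `e` contains a plain integer,
so does `f`, and plain integers increase weakly; if `e` contains a primed integer, so does `f`, and
primed integers increase strictly; a pair `(k, l')` is followed by some `(k + m, (l + m + 1)')`. -/
def RowRule (e f : Entry) : Prop :=
  (∀ k, e.plain? = some k → ∃ k', f.plain? = some k' ∧ k ≤ k') ∧
  (∀ l, e.primed? = some l → ∃ l', f.primed? = some l' ∧ l < l') ∧
  (∀ k l, e = .pair k l → ∃ m, f = .pair (k + m) (l + m + 1))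

/-- Compatibility of an entry `e` with the entry `f` below it: if `e` contains a plain integer,
so does `f`, and plain integers increase strictly; if `e` contains a primed integer, so does `f`,
and primed integers increase weakly; below a pair `(k, l')` is some `(k + m + 1, (l + m)')`. -/
def ColumnRule (e f : Entry) : Prop :=
  (∀ k, e.plain? = some k → ∃ k', f.plain? = some k' ∧ k < k') ∧
  (∀ l, e.primed? = some l → ∃ l', f.primed? = some l' ∧ l ≤ l') ∧
  (∀ k l, e = .pair k l → ∃ m, f = .pair (k + m + 1) (l + m))

/-- Compatibility of an entry with the diagonal `d` of its box.  The admissible entries come from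
integers `k` and `l = k + d`, by keeping those of `k`, `l'` that are positive. -/
def DiagonalRule (d : ℤ) : Entry → Prop
  | .plain k => (k : ℤ) ≤ -d
  | .primed l => (l : ℤ) ≤ d
  | .pair k l => (l : ℤ) - k = d

open Classical in
/-- The tableaux on `λ/μ` with flags `P`, `Q`. -/
noncomputable def tableaux {n : ℕ} (lam mu : Fin n → ℤ) (P Q : Fin n → ℕ) :
    Finset (Box lam mu → Entry) :=
  (Fintype.piFinset fun b : Box lam mu => entries (P b.1) (Q b.1)).filter fun T =>
    (∀ b b' : Box lam mu, b'.IsRightOf b → RowRule (T b) (T b')) ∧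
    (∀ b b' : Box lam mu, b'.IsBelow b → ColumnRule (T b) (T b')) ∧
    ∀ b : Box lam mu, DiagonalRule b.diag (T b)

namespace CompleteTriple.Division

variable {n : ℕ} {τ : CompleteTriple n} (D : τ.Division)

/-- The weight of an entry after the substitution: `u_k` for `k`, `v_l` for `l'`, and `u_k + v_l`
for `(k, l')`; a polynomial with coefficients in `ℕ` in the variables `x_k, y_k, x̃_k, ỹ_k`. -/
noncomputable def entryWeight : Entry → MvPolynomial Letter ℕ
  | .plain k => MvPolynomial.X (D.uLetter k)
  | .primed l => MvPolynomial.X (D.vLetter l)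
  | .pair k l => MvPolynomial.X (D.uLetter k) + MvPolynomial.X (D.vLetter l)

/-- The sum of the weights of all tableaux on `λ/μ`. -/
noncomputable def tableauSum (mu : Fin n → ℤ) : MvPolynomial Letter ℕ :=
  ∑ T ∈ tableaux τ.shape mu D.plainFlag D.primedFlag, ∏ b, D.entryWeight (T b)

end CompleteTriple.Division

open Classical in
/-- The partitions `μ ⊂ λ` of length at most `n`, as sequences of length `n`. -/
noncomputable def subpartitions {n : ℕ} (lam : Fin n → ℤ) : Finset (Fin n → ℤ) :=
  (Fintype.piFinset fun i => Finset.Icc 0 (lam i)).filter fun mu => Antitone mu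

end Vexillary

/-! A tableau entry on the diagonal `d = j - i` is encoded by one integer `k`, with `l = k + d`: the
entry keeps whichever of `k`, `l'` is positive. If `u` and `v` are extended by zero to nonpositive
indices, the weight of every admissible entry becomes `u_k + v_{k+d}`, and the row and column rules
become weak increase along rows and strict increase down columns (`rowRule_ofInt`,
`columnRule_ofInt`). Since `Q_i = P_i + λ_i - i`, the bound on primed entries follows from `k ≤
P_i`. Tableaux are thus flagged fillings by integers, nonpositive ones included.

The generating function of these fillings equals the determinant `pathDet` because both satisfy F(λ,
P) = F(λ, P - e_i) + (u_{P_i} + v_{P_i + λ_i - i}) F(λ - e_i, P), where `i` is the first row with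
the largest flag. For fillings this separates the cases in which the last entry of row `i` is or is
not `P_i`. For the determinant it is linearity in row `i` together with a one-line identity of
series (`flagSeries_eq`). The terms that do not come from a valid shape vanish on both sides, and
very negative flags start the induction (`sum_fillingWeight_aux`).

The words for `u` and `v` are built so that the first `Q_i` letters `v` and the first `P_i` letters
`u` are, for every row `i`, exactly those in the numerator and denominator of `a(i)`
(`prod_vLetter`, `prod_uLetter`). Hence each `a(i)` is the flag series of row `i`, which gives the
tableau formula.

For the enriched polynomial, the matrix of coefficients of `a(k) c` is a product of two matrices.
Cauchy–Binet (`det_sum_mul`) expands its determinant over strictly decreasing sequences `μ_j - j`,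
and only partitions `μ ⊂ λ` contribute (`schur_mul`). -/

namespace Vexillary

/-! ### Determinants: Cauchy–Binet and zero blocks -/

section LinearAlgebra

variable {R : Type*} [CommRing R] {n : ℕ}

/-- The **Cauchy–Binet formula**, with the minors indexed by strictly decreasing sequences. -/
theorem det_sum_mul {ι : Type*} [LinearOrder ι] (Z : Finset ι) (A : Fin n → ι → R)
    (B : ι → Fin n → R) :
    Matrix.det (Matrix.of fun k l : Fin n => ∑ z ∈ Z, A k z * B z l) =
      ∑ g ∈ (Fintype.piFinset fun _ : Fin n => Z) with StrictAnti g,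
        Matrix.det (Matrix.of fun k j : Fin n => A k (g j)) *
          Matrix.det (Matrix.of fun j l : Fin n => B (g j) l) := by
  classical
  have expand : Matrix.det (Matrix.of fun k l : Fin n => ∑ z ∈ Z, A k z * B z l) =
      ∑ f ∈ Fintype.piFinset fun _ : Fin n => Z,
        (∏ k, A k (f k)) * Matrix.det (Matrix.of fun j l : Fin n => B (f j) l) := by
    have h := (Matrix.detRowAlternating : (Fin n → R) [⋀^Fin n]→ₗ[R] R).toMultilinearMap
      |>.map_sum_finset (fun k z => A k z • B z) (fun _ => Z)
    have h2 : (Matrix.of fun k l : Fin n => ∑ z ∈ Z, A k z * B z l) =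
        (fun k => ∑ z ∈ Z, A k z • B z) := by
      ext k l
      simp [Finset.sum_apply]
    rw [h2]
    refine h.trans (Finset.sum_congr rfl fun f _ => ?_)
    exact (Matrix.detRowAlternating : (Fin n → R) [⋀^Fin n]→ₗ[R] R).toMultilinearMap.map_smul_univ
      (fun k => A k (f k)) (fun k => B (f k))
  -- A non-injective `f` repeats a row of `B`, so only injective `f` contribute.
  rw [expand, ← Finset.sum_filter_of_ne (p := fun f : Fin n → ι => Function.Injective f)]
  swap
  · intro f _ hne
    by_contra hinj
    refine hne ?_
    have := (Matrix.detRowAlternating : (Fin n → R) [⋀^Fin n]→ₗ[R] R).map_eq_zero_of_not_injective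
      (fun j => B (f j)) (fun h => hinj fun a b hab => h (by simp [hab]))
    rw [show Matrix.det (Matrix.of fun j l : Fin n => B (f j) l) = 0 from this, mul_zero]
  -- Permuting the rows of the second determinant absorbs the sign of `σ`. It remains to match pairs
  -- `(g, σ)`, `g` strictly decreasing, with injective maps `f = g ∘ σ`.
  have rhs : ∀ g : Fin n → ι, Matrix.det (Matrix.of fun k j : Fin n => A k (g j)) *
      Matrix.det (Matrix.of fun j l : Fin n => B (g j) l) = ∑ σ : Equiv.Perm (Fin n),
        (∏ k, A k (g (σ k))) * Matrix.det (Matrix.of fun j l : Fin n => B (g (σ j)) l) := by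
    intro g
    rw [← Matrix.det_transpose, Matrix.det_apply', Finset.sum_mul]
    refine Finset.sum_congr rfl fun σ _ => ?_
    have := Matrix.det_permute σ (Matrix.of fun j l : Fin n => B (g j) l)
    rw [show (Matrix.of fun j l : Fin n => B (g (σ j)) l) =
      (Matrix.of fun j l : Fin n => B (g j) l).submatrix σ id from rfl, this]
    simp only [Matrix.transpose_apply, Matrix.of_apply]
    ring
  simp_rw [rhs]
  rw [← Finset.sum_product']
  symm
  refine Finset.sum_bij (fun gσ _ => gσ.1 ∘ gσ.2) ?_ ?_ ?_ ?_
  · rintro ⟨g, σ⟩ h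
    simp only [Finset.mem_product, Finset.mem_filter, Fintype.mem_piFinset, Finset.mem_univ,
      and_true] at h
    simp only [Finset.mem_filter, Fintype.mem_piFinset, Function.comp_apply]
    exact ⟨fun a => h.1 _, h.2.injective.comp σ.injective⟩
  · rintro ⟨g, σ⟩ h ⟨g', σ'⟩ h' e
    simp only [Finset.mem_product, Finset.mem_filter, Fintype.mem_piFinset, Finset.mem_univ,
      and_true] at h h'
    simp only at e
    have e1 : (g ∘ σ) ∘ σ.symm = g := by ext; simp
    have e2 : (g ∘ σ) ∘ σ'.symm = g' := by rw [e]; ext; simp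
    have e3 : g = g' := by
      have := Tuple.unique_antitone (f := g ∘ σ) (σ := σ.symm) (τ := σ'.symm)
        (by rw [e1]; exact h.2.antitone) (by rw [e2]; exact h'.2.antitone)
      rwa [e1, e2] at this
    subst e3
    have : σ = σ' := Equiv.ext fun a => h.2.injective (congrFun e a)
    rw [this]
  · intro f hf
    simp only [Finset.mem_filter, Fintype.mem_piFinset] at hf
    -- Sorting in the order dual arranges the values in decreasing order.
    let σ : Equiv.Perm (Fin n) := Tuple.sort (OrderDual.toDual ∘ f)
    have hm : Monotone ((OrderDual.toDual ∘ f) ∘ σ) := Tuple.monotone_sort _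
    have ha : Antitone (f ∘ σ) := fun a b hab => hm hab
    refine ⟨(f ∘ σ, σ.symm), ?_, by ext; simp⟩
    simp only [Finset.mem_product, Finset.mem_filter, Fintype.mem_piFinset, Finset.mem_univ,
      and_true]
    exact ⟨fun a => hf.1 _, ha.strictAnti_of_injective (hf.2.comp σ.injective)⟩
  · rintro ⟨g, σ⟩ _
    rfl

/-- A square matrix with a zero block meeting the diagonal has determinant zero. -/
theorem det_eq_zero_of_zero_block (M : Matrix (Fin n) (Fin n) R) (i : Fin n)
    (h : ∀ k l, i ≤ k → l ≤ i → M k l = 0) : M.det = 0 := by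
  rw [Matrix.det_apply']
  refine Finset.sum_eq_zero fun σ _ => ?_
  -- Pigeonhole: a permutation cannot send the indices `≤ i` injectively to the indices `< i`, so
  -- each term of the expansion has a factor in the block.
  have : ∃ j, j ≤ i ∧ i ≤ σ j := by
    by_contra! hc
    have := Finset.card_le_card_of_injOn (s := Finset.Iic i) (t := Finset.Iio i) σ
      (fun j hj => by simpa using hc j (by simpa using hj)) σ.injective.injOn
    simp at this
  obtain ⟨j, hj, hj'⟩ := this
  exact mul_eq_zero_of_right _ (Finset.prod_eq_zero (Finset.mem_univ j) (h _ _ hj' hj))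

end LinearAlgebra

/-! ### Coefficients of series and the recursion for path sums -/

section Series

open PowerSeries

variable {R : Type*} [CommRing R]

theorem intCoeff_add (f g : PowerSeries R) (m : ℤ) :
    intCoeff (f + g) m = intCoeff f m + intCoeff g m := by
  unfold intCoeff
  split_ifs <;> simp

theorem intCoeff_C_mul_X_mul (c : R) (f : PowerSeries R) (m : ℤ) :
    intCoeff (C c * X * f) m = c * intCoeff f (m - 1) := by
  unfold intCoeff
  rw [mul_assoc]
  rcases lt_trichotomy m 0 with h | h | h
  · rw [if_neg (by omega), if_neg (by omega), mul_zero]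
  · subst h
    simp
  · rw [if_pos h.le, if_pos (by omega), coeff_C_mul]
    obtain ⟨k, rfl⟩ : ∃ k : ℕ, m = k + 1 := ⟨(m - 1).toNat, by omega⟩
    rw [show ((k : ℤ) + 1).toNat = k + 1 by omega, show ((k : ℤ) + 1 - 1).toNat = k by omega,
      coeff_succ_X_mul]

theorem intCoeff_one (m : ℤ) : intCoeff (1 : PowerSeries R) m = if m = 0 then 1 else 0 := by
  unfold intCoeff
  rcases lt_trichotomy m 0 with h | h | h
  · rw [if_neg (by omega), if_neg (by omega)]
  · simp [h]
  · rw [if_pos h.le, coeff_one, if_neg (by omega), if_neg (by omega)]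

theorem intCoeff_of_neg (f : PowerSeries R) {m : ℤ} (h : m < 0) : intCoeff f m = 0 :=
  if_neg (by omega)

/-- The coefficients of a product, as a sum over any interval that contains all nonzero terms. -/
theorem intCoeff_mul (f g : PowerSeries R) (s t A B : ℤ) (hA : A ≤ -t) (hB : s ≤ B) :
    intCoeff (f * g) (s + t) = ∑ z ∈ Finset.Icc A B, intCoeff f (s - z) * intCoeff g (z + t) := by
  -- Outside `[-t, s]` one of the two coefficients has negative index.
  rw [← Finset.sum_subset (Finset.Icc_subset_Icc hA hB)]
  swap
  · intro z _ hz
    rw [Finset.mem_Icc, not_and_or] at hz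
    rcases hz with hz | hz
    · rw [intCoeff_of_neg g (by omega), mul_zero]
    · rw [intCoeff_of_neg f (by omega), zero_mul]
  by_cases h : 0 ≤ s + t
  · rw [intCoeff, if_pos h, coeff_mul]
    refine Finset.sum_bij' (fun ij _ => s - ij.1) (fun z _ => ((s - z).toNat, (z + t).toNat))
      ?_ ?_ ?_ ?_ ?_
    · rintro ⟨i, j⟩ hij
      rw [Finset.HasAntidiagonal.mem_antidiagonal] at hij
      rw [Finset.mem_Icc]
      simp only at hij ⊢
      omega
    · intro z hz
      rw [Finset.mem_Icc] at hz
      rw [Finset.HasAntidiagonal.mem_antidiagonal]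
      simp only
      omega
    · rintro ⟨i, j⟩ hij
      rw [Finset.HasAntidiagonal.mem_antidiagonal] at hij
      simp only [Prod.mk.injEq] at hij ⊢
      omega
    · intro z hz
      rw [Finset.mem_Icc] at hz
      simp only
      omega
    · rintro ⟨i, j⟩ hij
      rw [Finset.HasAntidiagonal.mem_antidiagonal] at hij
      simp only at hij ⊢
      rw [intCoeff, intCoeff, if_pos (by omega), if_pos (by omega)]
      congr 3 <;> omega
  · rw [intCoeff_of_neg _ (by omega), Finset.Icc_eq_empty (by omega), Finset.sum_empty]

/-- The series `∏_{l=1}^Q (1 + v_l t) / ∏_{k=1}^P (1 - u_k t)`. -/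
noncomputable def flagSeries (u v : ℤ → R) (P Q : ℤ) : PowerSeries R :=
  (∏ l ∈ Finset.Icc 1 Q, (1 + C (v l) * X)) *
    invOfUnit (∏ k ∈ Finset.Icc 1 P, (1 - C (u k) * X)) 1

theorem prod_one_sub_mul_inv (u : ℤ → R) (P : ℤ) :
    (∏ k ∈ Finset.Icc 1 P, (1 - C (u k) * X)) *
      invOfUnit (∏ k ∈ Finset.Icc 1 P, (1 - C (u k) * X)) 1 = 1 :=
  mul_invOfUnit _ _ (by simp [map_prod])

theorem prod_Icc_one_eq (g : ℤ → PowerSeries R) (hg : ∀ k ≤ 0, g k = 1) (P : ℤ) :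
    ∏ k ∈ Finset.Icc 1 P, g k = (∏ k ∈ Finset.Icc 1 (P - 1), g k) * g P := by
  rcases le_or_gt P 0 with h | h
  · rw [Finset.Icc_eq_empty (by omega), Finset.Icc_eq_empty (by omega), hg P h]
    simp
  · have : Finset.Icc 1 P = insert P (Finset.Icc 1 (P - 1)) := by
      ext k
      simp only [Finset.mem_Icc, Finset.mem_insert]
      omega
    rw [this, Finset.prod_insert (by simp), mul_comm]

/-- With `F` the series for `(P, Q - 1)`, this is `(1 + v_Q t) F = (1 - u_P t) F + (u_P + v_Q) t F`.
Because `u` and `v` vanish at nonpositive indices, splitting off the last factor is valid for all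
integers `P` and `Q`, not only positive ones. -/
theorem flagSeries_eq {u v : ℤ → R} (hu : ∀ k ≤ 0, u k = 0) (hv : ∀ k ≤ 0, v k = 0) (P Q : ℤ) :
    flagSeries u v P Q = flagSeries u v (P - 1) (Q - 1) +
      C (u P + v Q) * X * flagSeries u v P (Q - 1) := by
  have h1 := prod_Icc_one_eq (fun l => 1 + C (v l) * X) (fun k hk => by simp [hv k hk]) Q
  have h2 := prod_Icc_one_eq (fun l => 1 - C (u l) * X) (fun k hk => by simp [hu k hk]) P
  have h3 := prod_one_sub_mul_inv u P
  have h4 := prod_one_sub_mul_inv u (P - 1)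
  unfold flagSeries
  rw [map_add]
  generalize invOfUnit (∏ k ∈ Finset.Icc 1 P, (1 - C (u k) * X)) 1 = G at *
  generalize invOfUnit (∏ k ∈ Finset.Icc 1 (P - 1), (1 - C (u k) * X)) 1 = G' at *
  rw [h2] at h3
  rw [h1]
  -- Both sides are inverse to the product over `k ≤ P - 1`.
  have h5 : G' = (1 - C (u P) * X) * G := by linear_combination h4 * (1 - C (u P) * X) * G - h3 * G'
  rw [h5]
  ring

/-- The sum of the weights of the lattice paths from column `a` to column `b` that end at height
`P`, where a step to column `c` at height `k` has weight `u_k + v_{k+c}`. -/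
noncomputable def pathSum (u v : ℤ → R) (P b a : ℤ) : R :=
  intCoeff (flagSeries u v P (P + b)) (b - a)

theorem pathSum_eq {u v : ℤ → R} (hu : ∀ k ≤ 0, u k = 0) (hv : ∀ k ≤ 0, v k = 0) (P b a : ℤ) :
    pathSum u v P b a =
      pathSum u v (P - 1) b a + (u P + v (P + b)) * pathSum u v P (b - 1) a := by
  unfold pathSum
  rw [flagSeries_eq hu hv, intCoeff_add, intCoeff_C_mul_X_mul]
  congr 3 <;> ring_nf

theorem pathSum_of_nonpos (u v : ℤ → R) {P b : ℤ} (a : ℤ) (hP : P ≤ 0) (hb : P + b ≤ 0) :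
    pathSum u v P b a = if b = a then 1 else 0 := by
  unfold pathSum flagSeries
  rw [Finset.Icc_eq_empty (by omega), Finset.Icc_eq_empty (by omega)]
  have : invOfUnit (1 : PowerSeries R) 1 = 1 := by
    simpa using mul_invOfUnit (1 : PowerSeries R) 1 (by simp)
  simp only [Finset.prod_empty, this, mul_one, intCoeff_one, sub_eq_zero]

theorem pathSum_of_lt (u v : ℤ → R) (P : ℤ) {a b : ℤ} (h : b < a) : pathSum u v P b a = 0 :=
  intCoeff_of_neg _ (by omega)

end Series

/-! ### Flagged fillings by integers and their determinant -/

section Fillings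

variable {R : Type*} [CommRing R] {n : ℕ}

/-- The fillings of `λ/μ` by integers `k ≤ P_i`, weakly increasing in rows and strictly increasing
in columns, such that `k` or `k + j - i` is positive in every box; the value is `0` outside of the
diagram. -/
structure IsFilling (lam mu P : Fin n → ℤ) (f : Fin n → ℤ → ℤ) : Prop where
  off : ∀ i j, ¬ (mu i < j ∧ j ≤ lam i) → f i j = 0
  pos : ∀ i j, mu i < j → j ≤ lam i → 1 ≤ f i j ∨ 1 ≤ f i j + (j - ((i : ℤ) + 1))
  le : ∀ i j, mu i < j → j ≤ lam i → f i j ≤ P i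
  row : ∀ i j j', mu i < j → j ≤ j' → j' ≤ lam i → f i j ≤ f i j'
  col : ∀ i i' : Fin n, ∀ j, (i' : ℕ) = (i : ℕ) + 1 → mu i < j → j ≤ lam i → mu i' < j →
    j ≤ lam i' → f i j < f i' j

/-- The weight of a filling: the product of `u_k + v_{k+j-i}` over all boxes. -/
noncomputable def fillingWeight (u v : ℤ → R) (lam mu : Fin n → ℤ) (f : Fin n → ℤ → ℤ) : R :=
  ∏ i, ∏ j ∈ Finset.Ioc (mu i) (lam i), (u (f i j) + v (f i j + (j - ((i : ℤ) + 1))))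

/-- The determinant of path sums for the flag `P`. -/
noncomputable def pathDet (u v : ℤ → R) (lam mu P : Fin n → ℤ) : R :=
  Matrix.det (Matrix.of fun k l : Fin n =>
    pathSum u v (P k) (lam k - ((k : ℤ) + 1)) (mu l - ((l : ℤ) + 1)))

theorem fillingWeight_congr (u v : ℤ → R) (lam mu : Fin n → ℤ) {f g : Fin n → ℤ → ℤ}
    (h : ∀ i j, mu i < j → j ≤ lam i → f i j = g i j) :
    fillingWeight u v lam mu f = fillingWeight u v lam mu g := by
  refine Finset.prod_congr rfl fun i _ => Finset.prod_congr rfl fun j hj => ?_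
  rw [Finset.mem_Ioc] at hj
  rw [h i j hj.1 hj.2]

theorem fillingWeight_eq_mul (u v : ℤ → R) (lam mu : Fin n → ℤ) (f : Fin n → ℤ → ℤ) (i : Fin n)
    (hi : mu i < lam i) :
    fillingWeight u v lam mu f =
      (u (f i (lam i)) + v (f i (lam i) + (lam i - ((i : ℤ) + 1)))) *
        fillingWeight u v (Function.update lam i (lam i - 1)) mu f := by
  unfold fillingWeight
  rw [← Finset.mul_prod_erase _ _ (Finset.mem_univ i),
    ← Finset.mul_prod_erase Finset.univ
      (fun i' => ∏ j ∈ Finset.Ioc (mu i') (Function.update lam i (lam i - 1) i'), _)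
      (Finset.mem_univ i), ← mul_assoc]
  congr 1
  · have : Finset.Ioc (mu i) (lam i) = insert (lam i) (Finset.Ioc (mu i) (lam i - 1)) := by
      ext k
      simp only [Finset.mem_Ioc, Finset.mem_insert]
      omega
    rw [this, Finset.prod_insert (by simp), Function.update_self]
  · refine Finset.prod_congr rfl fun j hj => ?_
    rw [Function.update_of_ne (Finset.ne_of_mem_erase hj)]

/-- Linearity of the determinant in row `i`, applied to `pathSum_eq`; the other rows are unchanged.
-/
theorem pathDet_eq {u v : ℤ → R} (hu : ∀ k ≤ 0, u k = 0) (hv : ∀ k ≤ 0, v k = 0)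
    (lam mu P : Fin n → ℤ) (i : Fin n) :
    pathDet u v lam mu P = pathDet u v lam mu (Function.update P i (P i - 1)) +
      (u (P i) + v (P i + (lam i - ((i : ℤ) + 1)))) *
        pathDet u v (Function.update lam i (lam i - 1)) mu P := by
  set M : Matrix (Fin n) (Fin n) R := Matrix.of fun k l : Fin n =>
    pathSum u v (P k) (lam k - ((k : ℤ) + 1)) (mu l - ((l : ℤ) + 1)) with hM
  set w := u (P i) + v (P i + (lam i - ((i : ℤ) + 1)))
  have h0 : M = M.updateRow i
      ((fun l : Fin n => pathSum u v (P i - 1) (lam i - ((i : ℤ) + 1)) (mu l - ((l : ℤ) + 1))) +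
        w • fun l : Fin n =>
          pathSum u v (P i) (lam i - 1 - ((i : ℤ) + 1)) (mu l - ((l : ℤ) + 1))) := by
    ext k l
    rcases eq_or_ne k i with rfl | hk
    · rw [Matrix.updateRow_self, hM, Matrix.of_apply, pathSum_eq hu hv]
      simp only [Pi.add_apply, Pi.smul_apply, smul_eq_mul]
      congr 3
      ring
    · rw [Matrix.updateRow_ne hk]
  have h1 : (Matrix.of fun k l : Fin n => pathSum u v (Function.update P i (P i - 1) k)
      (lam k - ((k : ℤ) + 1)) (mu l - ((l : ℤ) + 1))) = M.updateRow i
      (fun l : Fin n => pathSum u v (P i - 1) (lam i - ((i : ℤ) + 1)) (mu l - ((l : ℤ) + 1))) := by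
    ext k l
    rcases eq_or_ne k i with rfl | hk
    · simp
    · simp [Matrix.updateRow_ne hk, Function.update_of_ne hk, hM]
  have h2 : (Matrix.of fun k l : Fin n => pathSum u v (P k)
      (Function.update lam i (lam i - 1) k - ((k : ℤ) + 1)) (mu l - ((l : ℤ) + 1))) = M.updateRow i
      (fun l : Fin n => pathSum u v (P i) (lam i - 1 - ((i : ℤ) + 1)) (mu l - ((l : ℤ) + 1))) := by
    ext k l
    rcases eq_or_ne k i with rfl | hk
    · simp
    · simp [Matrix.updateRow_ne hk, Function.update_of_ne hk, hM]
  unfold pathDet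
  rw [h1, h2, ← hM, ← Matrix.det_updateRow_smul, ← Matrix.det_updateRow_add, ← h0]

/-- Handles the shape left when a box is removed from an empty row. That shape need not be a
partition, so the hypothesis asks only that the later `λ_k - k` do not exceed `λ_i - i`; this
suffices for a zero block. -/
theorem pathDet_eq_zero_of_lt (u v : ℤ → R) {lam mu : Fin n → ℤ} (P : Fin n → ℤ) (i : Fin n)
    (hmu : Antitone mu) (hi : lam i < mu i)
    (hlam' : ∀ k, i < k → lam k - ((k : ℤ) + 1) ≤ lam i - ((i : ℤ) + 1)) :
    pathDet u v lam mu P = 0 := by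
  refine det_eq_zero_of_zero_block _ i fun k l hk hl => pathSum_of_lt _ _ _ ?_
  have h1 := hmu hl
  have h2 : (l : ℤ) ≤ i := by exact_mod_cast hl
  rcases hk.eq_or_lt with rfl | hk
  · omega
  · have := hlam' k hk
    omega

/-- For such a low flag all the flag series equal `1`, so the matrix records the equalities `λ_k - k
= μ_l - l`. It is lower triangular, since `μ_l - l < μ_k - k ≤ λ_k - k` for `k < l`. -/
theorem pathDet_bottom (u v : ℤ → R) {lam mu : Fin n → ℤ} {B : ℤ} (hB : B ≤ 0)
    (hlamB : ∀ i, B + lam i ≤ 0) (hmu : Antitone mu) (hle : ∀ i, mu i ≤ lam i) :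
    pathDet u v lam mu (fun _ => B) = ∏ i, if lam i = mu i then 1 else 0 := by
  unfold pathDet
  rw [Matrix.det_of_isLowerTriangular]
  · refine Finset.prod_congr rfl fun i _ => ?_
    rw [Matrix.of_apply, pathSum_of_nonpos _ _ _ hB (by have := hlamB i; omega)]
    congr 1
    simp
  · intro k l hkl
    have hkl : k < l := hkl
    have h1 := hmu hkl.le
    have h2 := hle k
    have h3 : (k : ℤ) < l := by exact_mod_cast hkl
    rw [Matrix.of_apply, pathSum_of_nonpos _ _ _ hB (by have := hlamB k; omega), if_neg (by omega)]

/-- Selects the row for the recursion. Lowering the flag of the first row with the largest flag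
keeps the flags monotone, and all rows above it have strictly smaller entries. -/
theorem exists_first_max {P : Fin n → ℤ} (hP : Monotone P) {B : ℤ} (h : ∃ i, B < P i) :
    ∃ i, B < P i ∧ (∀ j < i, P j < P i) ∧ ∀ j, i ≤ j → P j = P i := by
  obtain ⟨i₀, h₀⟩ := h
  have : Nonempty (Fin n) := ⟨i₀⟩
  obtain ⟨m, hm⟩ := Finite.exists_max P
  obtain ⟨i, hi, hmin⟩ := wellFounded_lt.has_min {i : Fin n | P i = P m} ⟨m, rfl⟩
  have hi : P i = P m := hi
  refine ⟨i, by have := hm i₀; omega, fun j hj => ?_, fun j hj => ?_⟩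
  · have h1 := hm j
    have h2 : P j ≠ P m := fun h => hmin j h hj
    omega
  · have h1 := hm j
    have h2 := hP hj
    omega

/-- The last box of a nonempty row would need `k` or `k + λ_i - i` positive, but the flag makes both
nonpositive. -/
theorem isFilling_bottom {lam mu P : Fin n → ℤ} (hP : ∀ i, P i ≤ 0) (hPl : ∀ i, P i + lam i ≤ 0)
    (f : Fin n → ℤ → ℤ) : IsFilling lam mu P f ↔ f = 0 ∧ ∀ i, lam i ≤ mu i := by
  constructor
  · intro h
    have hall : ∀ i, lam i ≤ mu i := by
      intro i
      by_contra! hi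
      have h1 := h.pos i _ hi le_rfl
      have h2 := h.le i _ hi le_rfl
      have h3 := hP i
      have h4 := hPl i
      omega
    refine ⟨?_, hall⟩
    ext i j
    exact h.off i j (by have := hall i; omega)
  · rintro ⟨rfl, hall⟩
    refine ⟨fun _ _ _ => rfl, ?_, ?_, ?_, ?_⟩
    · intro i j h1 h2
      have := hall i
      omega
    · intro i j h1 h2
      have := hall i
      omega
    · intro i j j' h1 h2 h3
      rfl
    · intro i i' j _ h1 h2
      have := hall i
      omega

/-- The fillings whose last entry in row `i` is not the largest possible one. -/
theorem isFilling_update_flag {lam mu P : Fin n → ℤ} (i : Fin n) (f : Fin n → ℤ → ℤ) :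
    IsFilling lam mu (Function.update P i (P i - 1)) f ↔
      IsFilling lam mu P f ∧ (mu i < lam i → f i (lam i) ≠ P i) := by
  constructor
  · intro h
    refine ⟨⟨h.off, h.pos, fun k j h1 h2 => ?_, h.row, h.col⟩, fun hi => ?_⟩
    · have := h.le k j h1 h2
      rcases eq_or_ne k i with rfl | hk
      · rw [Function.update_self] at this
        omega
      · rwa [Function.update_of_ne hk] at this
    · have := h.le i (lam i) hi le_rfl
      rw [Function.update_self] at this
      omega
  · rintro ⟨h, hne⟩
    refine ⟨h.off, h.pos, fun k j h1 h2 => ?_, h.row, h.col⟩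
    rcases eq_or_ne k i with rfl | hk
    · have h3 := h.row k j (lam k) h1 h2 le_rfl
      have h4 := h.le k (lam k) (by omega) le_rfl
      have h5 := hne (by omega)
      rw [Function.update_self]
      omega
    · rw [Function.update_of_ne hk]
      exact h.le k j h1 h2

/-- The box below the last box of row `i` lies in the diagram because `μ` is decreasing; its entry
would have to exceed the common flag. -/
theorem IsFilling.ne_of_below {lam mu P : Fin n → ℤ} {f : Fin n → ℤ → ℤ} (h : IsFilling lam mu P f)
    (hmu : Antitone mu) {i i' : Fin n} (hi : mu i < lam i) (hii : (i' : ℕ) = (i : ℕ) + 1)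
    (hlam : lam i' = lam i) (hP : P i' = P i) : f i (lam i) ≠ P i := by
  have h1 := hmu (show i ≤ i' from Fin.le_def.2 (by omega))
  have h2 := h.col i i' (lam i) hii hi le_rfl (by omega) (by omega)
  have h3 := h.le i' (lam i) (by omega) (by omega)
  omega

/-- Replacing the value in the box `(i, j)` by `k`. -/
def setBox (i : Fin n) (j : ℤ) (f : Fin n → ℤ → ℤ) (k : ℤ) : Fin n → ℤ → ℤ :=
  fun i' j' => if i' = i ∧ j' = j then k else f i' j'

theorem IsFilling.eraseBox {lam mu P : Fin n → ℤ} {f : Fin n → ℤ → ℤ} (h : IsFilling lam mu P f)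
    (i : Fin n) :
    IsFilling (Function.update lam i (lam i - 1)) mu P (setBox i (lam i) f 0) := by
  have hle : ∀ k j, j ≤ Function.update lam i (lam i - 1) k →
      j ≤ lam k ∧ ¬ (k = i ∧ j = lam i) := by
    intro k j hj
    rcases eq_or_ne k i with rfl | hk
    · rw [Function.update_self] at hj
      exact ⟨by omega, by omega⟩
    · rw [Function.update_of_ne hk] at hj
      exact ⟨hj, by tauto⟩
  unfold setBox
  refine ⟨fun k j hj => ?_, fun k j h1 h2 => ?_, fun k j h1 h2 => ?_,
    fun k j j' h1 h2 h3 => ?_, fun k k' j hk h1 h2 h3 h4 => ?_⟩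
  · split_ifs with hkj
    · rfl
    · refine h.off k j fun hc => hj ⟨hc.1, ?_⟩
      rcases eq_or_ne k i with rfl | hk
      · rw [Function.update_self]
        have : j ≠ lam k := by tauto
        omega
      · rw [Function.update_of_ne hk]
        exact hc.2
  · rw [if_neg (hle k j h2).2]
    exact h.pos k j h1 (hle k j h2).1
  · rw [if_neg (hle k j h2).2]
    exact h.le k j h1 (hle k j h2).1
  · rw [if_neg (hle k j (h2.trans h3)).2, if_neg (hle k j' h3).2]
    exact h.row k j j' h1 h2 (hle k j' h3).1
  · rw [if_neg (hle k j h2).2, if_neg (hle k' j h4).2]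
    exact h.col k k' j hk h1 (hle k j h2).1 h3 (hle k' j h4).1

/-- `hfirst` makes the new entry larger than any entry above it, `hcorner` ensures that no box lies
below it, and the flag bounds the rest of row `i`. -/
theorem IsFilling.insertBox {lam mu P : Fin n → ℤ} {f : Fin n → ℤ → ℤ} (i : Fin n)
    (h : IsFilling (Function.update lam i (lam i - 1)) mu P f) (hi : mu i < lam i)
    (hpos : 1 ≤ P i ∨ 1 ≤ P i + (lam i - ((i : ℤ) + 1)))
    (hfirst : ∀ j < i, P j < P i) (hcorner : ∀ j, i < j → lam j < lam i) :
    IsFilling lam mu P (setBox i (lam i) f (P i)) := by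
  have hle : ∀ k j, j ≤ lam k → ¬ (k = i ∧ j = lam i) →
      j ≤ Function.update lam i (lam i - 1) k := by
    intro k j hj hne
    rcases eq_or_ne k i with rfl | hk
    · rw [Function.update_self]
      have : j ≠ lam k := by tauto
      omega
    · rwa [Function.update_of_ne hk]
  unfold setBox
  refine ⟨fun k j hj => ?_, fun k j h1 h2 => ?_, fun k j h1 h2 => ?_,
    fun k j j' h1 h2 h3 => ?_, fun k k' j hk h1 h2 h3 h4 => ?_⟩
  · split_ifs with hkj
    · obtain ⟨rfl, rfl⟩ := hkj
      exact absurd ⟨hi, le_rfl⟩ hj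
    · refine h.off k j fun hc => hj ⟨hc.1, hc.2.trans ?_⟩
      rcases eq_or_ne k i with rfl | hk
      · rw [Function.update_self]
        omega
      · rw [Function.update_of_ne hk]
  · split_ifs with hkj
    · obtain ⟨rfl, rfl⟩ := hkj
      exact hpos
    · exact h.pos k j h1 (hle k j h2 hkj)
  · split_ifs with hkj
    · rw [hkj.1]
    · exact h.le k j h1 (hle k j h2 hkj)
  · by_cases hj' : k = i ∧ j' = lam i
    · rw [if_pos hj']
      obtain ⟨rfl, rfl⟩ := hj'
      split_ifs with hkj
      · rfl
      · exact h.le k j h1 (hle k j h2 hkj)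
    · have hj : ¬ (k = i ∧ j = lam i) := by
        rintro ⟨rfl, rfl⟩
        exact hj' ⟨rfl, le_antisymm h3 h2⟩
      rw [if_neg hj, if_neg hj']
      exact h.row k j j' h1 h2 (hle k j' h3 hj')
  · have hlt : k < k' := Fin.lt_def.2 (by omega)
    by_cases hj' : k' = i ∧ j = lam i
    · have hj : ¬ (k = i ∧ j = lam i) := fun hc => hlt.ne (hc.1.trans hj'.1.symm)
      rw [if_neg hj, if_pos hj']
      exact (h.le k j h1 (hle k j h2 hj)).trans_lt (hfirst k (hj'.1 ▸ hlt))
    · by_cases hj : k = i ∧ j = lam i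
      · obtain ⟨rfl, rfl⟩ := hj
        exact absurd (hcorner k' hlt) (by omega)
      · rw [if_neg hj, if_neg hj']
        exact h.col k k' j hk h1 (hle k j h2 hj) h3 (hle k' j h4 hj')

/-- Peeling off the last box of row `i` from the fillings that have the largest possible entry
there. -/
theorem sum_fillingWeight_corner {u v : ℤ → R} (hu : ∀ k ≤ 0, u k = 0) (hv : ∀ k ≤ 0, v k = 0)
    {lam mu P : Fin n → ℤ} (i : Fin n) (hi : mu i < lam i)
    (hfirst : ∀ j < i, P j < P i) (hcorner : ∀ j, i < j → lam j < lam i)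
    (S : Finset (Fin n → ℤ → ℤ)) (hS : ∀ f, f ∈ S ↔ IsFilling lam mu P f ∧ f i (lam i) = P i)
    {d : R} (hd : ∀ S' : Finset (Fin n → ℤ → ℤ),
      (∀ f, f ∈ S' ↔ IsFilling (Function.update lam i (lam i - 1)) mu P f) →
        ∑ f ∈ S', fillingWeight u v (Function.update lam i (lam i - 1)) mu f = d) :
    ∑ f ∈ S, fillingWeight u v lam mu f = (u (P i) + v (P i + (lam i - ((i : ℤ) + 1)))) * d := by
  classical
  -- If `P_i` is not an admissible entry of the last box, there are no fillings to sum, and the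
  -- factor on the right is zero because both of its indices are nonpositive.
  by_cases hpos : 1 ≤ P i ∨ 1 ≤ P i + (lam i - ((i : ℤ) + 1))
  · have hinj : Set.InjOn (fun f => setBox i (lam i) f 0) (S : Set (Fin n → ℤ → ℤ)) := by
      intro f hf g hg hfg
      have hf := (hS f).1 hf
      have hg := (hS g).1 hg
      ext k j
      have := congrFun (congrFun hfg k) j
      simp only [setBox] at this
      split_ifs at this with hkj
      · rw [hkj.1, hkj.2, hf.2, hg.2]
      · exact this
    rw [← hd (S.image fun f => setBox i (lam i) f 0), Finset.sum_image hinj, Finset.mul_sum]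
    · refine Finset.sum_congr rfl fun f hf => ?_
      rw [fillingWeight_eq_mul u v lam mu f i hi, ((hS f).1 hf).2]
      congr 1
      refine fillingWeight_congr _ _ _ _ fun k j h1 h2 => ?_
      rw [setBox, if_neg]
      rintro ⟨rfl, rfl⟩
      rw [Function.update_self] at h2
      omega
    · intro g
      rw [Finset.mem_image]
      constructor
      · rintro ⟨f, hf, rfl⟩
        exact ((hS f).1 hf).1.eraseBox i
      · intro hg
        refine ⟨setBox i (lam i) g (P i),
          (hS _).2 ⟨hg.insertBox i hi hpos hfirst hcorner, by simp [setBox]⟩, ?_⟩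
        ext k j
        simp only [setBox]
        split_ifs with hkj
        · rw [hkj.1, hkj.2, hg.off]
          rw [Function.update_self]
          omega
        · rfl
  · have hS0 : S = ∅ := by
      refine Finset.eq_empty_of_forall_notMem fun f hf => hpos ?_
      obtain ⟨h1, h2⟩ := (hS f).1 hf
      rw [← h2]
      exact h1.pos i _ hi le_rfl
    rw [hS0, Finset.sum_empty, hu _ (by omega), hv _ (by omega), add_zero, zero_mul]

theorem sum_update_sub (g : Fin n → ℤ) (i : Fin n) (c : Fin n → ℤ) :
    ∑ k, (Function.update g i (g i - 1) k - c k) = ∑ k, (g k - c k) - 1 := by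
  rw [← Finset.add_sum_erase _ _ (Finset.mem_univ i),
    ← Finset.add_sum_erase Finset.univ (fun k => g k - c k) (Finset.mem_univ i),
    Finset.sum_congr rfl fun k hk => by
      rw [Function.update_of_ne (Finset.ne_of_mem_erase hk)], Function.update_self]
  ring

/-- Induction on the number of boxes plus the total excess of the flags over a common lower bound
`B`, chosen so low that no box can be filled when all flags equal `B`. Each step of the recursion
lowers this number by one, either through the flag or through the shape. -/
theorem sum_fillingWeight_aux {u v : ℤ → R} (hu : ∀ k ≤ 0, u k = 0) (hv : ∀ k ≤ 0, v k = 0)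
    {mu : Fin n → ℤ} (hmu : Antitone mu) {B : ℤ} (hB : B ≤ 0) (N : ℕ) :
    ∀ lam P : Fin n → ℤ, Antitone lam → Monotone P → (∀ i, mu i ≤ lam i) → (∀ i, B ≤ P i) →
      (∀ i, B + lam i ≤ 0) → ∑ i, (lam i - mu i) + ∑ i, (P i - B) < N →
      ∀ S : Finset (Fin n → ℤ → ℤ), (∀ f, f ∈ S ↔ IsFilling lam mu P f) →
        ∑ f ∈ S, fillingWeight u v lam mu f = pathDet u v lam mu P := by
  classical
  induction N with
  | zero =>
    intro lam P _ _ hle hBP _ hN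
    have h1 : 0 ≤ ∑ i, (lam i - mu i) := Finset.sum_nonneg fun i _ => sub_nonneg.2 (hle i)
    have h2 : 0 ≤ ∑ i, (P i - B) := Finset.sum_nonneg fun i _ => sub_nonneg.2 (hBP i)
    push_cast at hN
    omega
  | succ N ih =>
    intro lam P hlam hP hle hBP hBl hN S hS
    push_cast at hN
    by_cases hbase : ∃ i, B < P i
    swap
    · push Not at hbase
      obtain rfl : P = fun _ => B := funext fun i => le_antisymm (hbase i) (hBP i)
      have hS' := fun f => (hS f).trans (isFilling_bottom (fun _ => hB) hBl f)
      rw [pathDet_bottom u v hB hBl hmu hle]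
      by_cases heq : ∀ i, lam i = mu i
      · have : S = {0} := by
          ext f
          rw [hS', Finset.mem_singleton]
          exact ⟨fun h => h.1, fun h => ⟨h, fun i => (heq i).le⟩⟩
        rw [this, Finset.sum_singleton, Finset.prod_congr rfl fun i _ => if_pos (heq i),
          fillingWeight]
        refine (Finset.prod_congr rfl fun i _ => ?_)
        rw [heq i, Finset.Ioc_self, Finset.prod_empty]
      · push Not at heq
        obtain ⟨i, hi⟩ := heq
        have : S = ∅ := Finset.eq_empty_of_forall_notMem fun f hf =>
          hi (le_antisymm (((hS' f).1 hf).2 i) (hle i))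
        rw [this, Finset.sum_empty, Finset.prod_eq_zero (Finset.mem_univ i) (if_neg hi)]
    obtain ⟨i, hBi, hfirst, hlast⟩ := exists_first_max hP hbase
    have hP' : Monotone (Function.update P i (P i - 1)) := by
      intro j k hjk
      rcases eq_or_ne k i with rfl | hk
      · rw [Function.update_self]
        rcases hjk.eq_or_lt with rfl | hj
        · rw [Function.update_self]
        · rw [Function.update_of_ne hj.ne]
          have := hfirst j hj
          omega
      · rw [Function.update_of_ne hk]
        have h1 := hP hjk
        rcases eq_or_ne j i with rfl | hj
        · rw [Function.update_self]
          omega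
        · rwa [Function.update_of_ne hj]
    have ihP := ih lam (Function.update P i (P i - 1)) hlam hP' hle
      (fun j => by
        rcases eq_or_ne j i with rfl | hj
        · rw [Function.update_self]
          omega
        · rw [Function.update_of_ne hj]
          exact hBP j) hBl
      (by rw [sum_update_sub]; omega)
    rw [pathDet_eq hu hv lam mu P i]
    -- If row `i` is empty, its flag does not constrain the fillings, and the determinant for the
    -- shape `λ - e_i` vanishes.
    rcases (hle i).eq_or_lt with hi | hi
    · rw [pathDet_eq_zero_of_lt u v P i, mul_zero, add_zero]
      · refine ihP S fun f => (hS f).trans ?_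
        rw [isFilling_update_flag]
        exact ⟨fun h => ⟨h, fun h' => absurd hi h'.ne⟩, fun h => h.1⟩
      · exact hmu
      · rw [Function.update_self]
        omega
      · intro k hk
        have := hlam hk.le
        have : (i : ℤ) < k := by exact_mod_cast hk
        rw [Function.update_self, Function.update_of_ne hk.ne']
        omega
    rw [← Finset.sum_filter_add_sum_filter_not S (fun f => f i (lam i) ≠ P i)]
    congr 1
    · refine ihP _ fun f => ?_
      rw [Finset.mem_filter, hS, isFilling_update_flag]
      tauto
    by_cases hcorner : ∀ j, i < j → lam j < lam i
    · refine sum_fillingWeight_corner hu hv i hi hfirst hcorner _ (fun f => ?_) fun S' hS' => ?_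
      · rw [Finset.mem_filter, hS, not_not]
      · refine ih (Function.update lam i (lam i - 1)) P ?_ hP ?_ hBP ?_ ?_ S' hS'
        · intro j k hjk
          rcases eq_or_ne k i with rfl | hk
          · rw [Function.update_self]
            have h1 := hlam hjk
            rcases eq_or_ne j k with rfl | hj
            · rw [Function.update_self]
            · rw [Function.update_of_ne hj]
              omega
          · rw [Function.update_of_ne hk]
            rcases eq_or_ne j i with rfl | hj
            · rw [Function.update_self]
              have := hcorner k (lt_of_le_of_ne hjk hk.symm)
              omega
            · rw [Function.update_of_ne hj]
              exact hlam hjk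
        · intro j
          rcases eq_or_ne j i with rfl | hj
          · rw [Function.update_self]
            omega
          · rw [Function.update_of_ne hj]
            exact hle j
        · intro j
          rcases eq_or_ne j i with rfl | hj
          · rw [Function.update_self]
            have := hBl j
            omega
          · rw [Function.update_of_ne hj]
            exact hBl j
        · rw [sum_update_sub]
          omega
    -- Row `i + 1` has the same length and the same flag as row `i`. No filling ends row `i` with
    -- `P_i`, and removing a box from row `i` makes the two matrix rows equal.
    · push Not at hcorner
      obtain ⟨j, hij, hj⟩ := hcorner
      have hlt : (i : ℕ) + 1 < n := by
        have := Fin.lt_def.1 hij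
        omega
      set i' : Fin n := ⟨i + 1, hlt⟩ with hi'
      have hii : i < i' := Fin.lt_def.2 (by simp [hi'])
      have hij' : i' ≤ j := Fin.le_def.2 (by simpa [hi'] using Fin.lt_def.1 hij)
      have hl : lam i' = lam i := by
        have h1 := hlam hii.le
        have h2 := hlam hij'
        omega
      have hPi := hlast i' hii.le
      have hempty : S.filter (fun f => ¬ f i (lam i) ≠ P i) = ∅ := by
        refine Finset.filter_eq_empty_iff.2 fun f hf => not_not.2 ?_
        exact ((hS f).1 hf).ne_of_below hmu hi rfl hl hPi
      have hdet : pathDet u v (Function.update lam i (lam i - 1)) mu P = 0 := by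
        refine Matrix.det_zero_of_row_eq hii.ne ?_
        ext l
        simp only [Matrix.of_apply]
        rw [Function.update_self, Function.update_of_ne hii.ne', hl, hPi]
        congr 1
        simp [hi']
        ring
      rw [hempty, hdet, Finset.sum_empty, mul_zero]

/-- The flagged double Jacobi–Trudi formula. -/
theorem sum_fillingWeight {u v : ℤ → R} (hu : ∀ k ≤ 0, u k = 0) (hv : ∀ k ≤ 0, v k = 0)
    {lam mu P : Fin n → ℤ} (hlam : Antitone lam) (hmu : Antitone mu) (hle : ∀ i, mu i ≤ lam i)
    (hP : Monotone P) (S : Finset (Fin n → ℤ → ℤ)) (hS : ∀ f, f ∈ S ↔ IsFilling lam mu P f) :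
    ∑ f ∈ S, fillingWeight u v lam mu f = pathDet u v lam mu P := by
  have hB : ∃ B : ℤ, B ≤ 0 ∧ ∀ i, B ≤ P i ∧ B + lam i ≤ 0 := by
    -- One crude bound that lies below every `P_i` and every `-λ_i`.
    refine ⟨-∑ i, (|P i| + |lam i|), ?_, fun i => ?_⟩
    · have : 0 ≤ ∑ i, (|P i| + |lam i|) := Finset.sum_nonneg fun i _ => by positivity
      omega
    · have h := Finset.single_le_sum (f := fun i => |P i| + |lam i|) (s := Finset.univ)
        (fun i _ => by positivity) (Finset.mem_univ i)
      have h1 := neg_abs_le (P i)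
      have h2 := le_abs_self (lam i)
      have h3 := abs_nonneg (P i)
      have h4 := abs_nonneg (lam i)
      constructor <;> omega
  obtain ⟨B, hB0, hB⟩ := hB
  exact sum_fillingWeight_aux hu hv hmu hB0
    ((∑ i, (lam i - mu i) + ∑ i, (P i - B)).toNat + 1) lam P hlam hP hle (fun i => (hB i).1)
    (fun i => (hB i).2) (by push_cast; omega) S hS

end Fillings

/-! ### Tableau entries encoded as integers -/

/-- The sequence `a_1, a_2, …`, extended by zero to all integers. -/
def extendZero {R : Type*} [Zero R] (a : ℕ → R) (k : ℤ) : R :=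
  if 0 < k then a k.toNat else 0

theorem extendZero_of_nonpos {R : Type*} [Zero R] (a : ℕ → R) (k : ℤ) (hk : k ≤ 0) :
    extendZero a k = 0 :=
  if_neg (by omega)

theorem extendZero_of_pos {R : Type*} [Zero R] (a : ℕ → R) {k : ℤ} (hk : 0 < k) :
    extendZero a k = a k.toNat :=
  if_pos hk

/-- The value of an entry, for given values of the plain and primed integers. -/
def Entry.value {R : Type*} [Add R] (a b : ℕ → R) : Entry → R
  | .plain k => a k
  | .primed l => b l
  | .pair k l => a k + b l

/-- The integer `k` from which an entry on the diagonal `d` arises. -/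
def Entry.toInt (d : ℤ) : Entry → ℤ
  | .plain k => k
  | .primed l => l - d
  | .pair k _ => k

/-- The entry on the diagonal `d` that arises from the integers `k` and `l = k + d`. -/
def Entry.ofInt (d k : ℤ) : Entry :=
  if 0 < k then if 0 < k + d then .pair k.toNat (k + d).toNat else .plain k.toNat
  else .primed (k + d).toNat

theorem mem_entries {P Q : ℕ} {e : Entry} : e ∈ entries P Q ↔ match e with
    | .plain k => 1 ≤ k ∧ k ≤ P
    | .primed l => 1 ≤ l ∧ l ≤ Q
    | .pair k l => (1 ≤ k ∧ k ≤ P) ∧ 1 ≤ l ∧ l ≤ Q := by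
  cases e <;> simp [entries, and_assoc]

/-- The diagonal rule for a lone plain `k` says that `k + d ≤ 0`, and for a lone primed `l'` that `l
- d ≤ 0`: the missing half of the entry is exactly the nonpositive one, so the encoding can be
undone. -/
theorem Entry.toInt_spec {P Q : ℕ} {e : Entry} {d : ℤ} (he : e ∈ entries P Q)
    (hd : DiagonalRule d e) :
    (1 ≤ e.toInt d ∨ 1 ≤ e.toInt d + d) ∧ e.toInt d ≤ P ∧ Entry.ofInt d (e.toInt d) = e := by
  rw [mem_entries] at he
  cases e with
  | plain k =>
    simp only [DiagonalRule] at he hd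
    change (1 ≤ (k : ℤ) ∨ 1 ≤ (k : ℤ) + d) ∧ (k : ℤ) ≤ P ∧ Entry.ofInt d (k : ℤ) = .plain k
    unfold Entry.ofInt
    rw [if_pos (by omega), if_neg (by omega)]
    refine ⟨by omega, by omega, by simp⟩
  | primed l =>
    simp only [DiagonalRule] at he hd
    change (1 ≤ ((l : ℤ) - d) ∨ 1 ≤ ((l : ℤ) - d) + d) ∧ ((l : ℤ) - d) ≤ P ∧
      Entry.ofInt d ((l : ℤ) - d) = .primed l
    unfold Entry.ofInt
    rw [if_neg (by omega)]
    refine ⟨by omega, by omega, by simp⟩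
  | pair k l =>
    simp only [DiagonalRule] at he hd
    change (1 ≤ (k : ℤ) ∨ 1 ≤ (k : ℤ) + d) ∧ (k : ℤ) ≤ P ∧ Entry.ofInt d (k : ℤ) = .pair k l
    unfold Entry.ofInt
    rw [if_pos (by omega), if_pos (by omega)]
    refine ⟨by omega, by omega, ?_⟩
    congr 1
    omega

theorem Entry.ofInt_spec {P Q : ℕ} {d k : ℤ} (h : 1 ≤ k ∨ 1 ≤ k + d) (hP : k ≤ P) (hQ : k + d ≤ Q) :
    Entry.ofInt d k ∈ entries P Q ∧ DiagonalRule d (Entry.ofInt d k) ∧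
      (Entry.ofInt d k).toInt d = k := by
  rw [mem_entries]
  unfold Entry.ofInt
  split_ifs <;> simp only [DiagonalRule, Entry.toInt] <;> omega

theorem Entry.plain?_ofInt (d k : ℤ) :
    (Entry.ofInt d k).plain? = if 0 < k then some k.toNat else none := by
  unfold Entry.ofInt
  split_ifs <;> rfl

theorem Entry.primed?_ofInt {d k : ℤ} (h : 1 ≤ k ∨ 1 ≤ k + d) :
    (Entry.ofInt d k).primed? = if 0 < k + d then some (k + d).toNat else none := by
  unfold Entry.ofInt
  split_ifs <;> first | rfl | omega

theorem Entry.ofInt_eq_pair {d k : ℤ} {a b : ℕ} :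
    Entry.ofInt d k = .pair a b ↔ 0 < k ∧ 0 < k + d ∧ k.toNat = a ∧ (k + d).toNat = b := by
  unfold Entry.ofInt
  split_ifs <;> simp <;> omega

/-- At least one of `k`, `k + d` is positive, and comparing that half already gives `k ≤ k'`.
Conversely, the rule for pairs holds with `m = k' - k`; the shift of the diagonal by one turns weak
increase of `k` into strict increase of `l`. -/
theorem rowRule_ofInt {d k k' : ℤ} (h : 1 ≤ k ∨ 1 ≤ k + d) (h' : 1 ≤ k' ∨ 1 ≤ k' + (d + 1)) :
    RowRule (Entry.ofInt d k) (Entry.ofInt (d + 1) k') ↔ k ≤ k' := by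
  unfold RowRule
  simp only [Entry.plain?_ofInt, Entry.primed?_ofInt h, Entry.primed?_ofInt h',
    Entry.ofInt_eq_pair, Option.ite_none_right_eq_some, Option.some.injEq]
  constructor
  · rintro ⟨h1, h2, -⟩
    by_cases hk : 0 < k
    · obtain ⟨a, ha, hb⟩ := h1 _ ⟨hk, rfl⟩
      omega
    · obtain ⟨a, ha, hb⟩ := h2 _ ⟨by omega, rfl⟩
      omega
  · intro hk
    refine ⟨fun a ha => ⟨k'.toNat, by omega, by omega⟩,
      fun a ha => ⟨(k' + (d + 1)).toNat, by omega, by omega⟩,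
      fun a b hab => ⟨(k' - k).toNat, by omega⟩⟩

theorem columnRule_ofInt {d k k' : ℤ} (h : 1 ≤ k ∨ 1 ≤ k + d) (h' : 1 ≤ k' ∨ 1 ≤ k' + (d - 1)) :
    ColumnRule (Entry.ofInt d k) (Entry.ofInt (d - 1) k') ↔ k < k' := by
  unfold ColumnRule
  simp only [Entry.plain?_ofInt, Entry.primed?_ofInt h, Entry.primed?_ofInt h',
    Entry.ofInt_eq_pair, Option.ite_none_right_eq_some, Option.some.injEq]
  constructor
  · rintro ⟨h1, h2, -⟩
    by_cases hk : 0 < k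
    · obtain ⟨a, ha, hb⟩ := h1 _ ⟨hk, rfl⟩
      omega
    · obtain ⟨a, ha, hb⟩ := h2 _ ⟨by omega, rfl⟩
      omega
  · intro hk
    refine ⟨fun a ha => ⟨k'.toNat, by omega, by omega⟩,
      fun a ha => ⟨(k' + (d - 1)).toNat, by omega, by omega⟩,
      fun a b hab => ⟨(k' - k - 1).toNat, by omega⟩⟩

theorem Entry.value_ofInt {R : Type*} [AddMonoid R] (a b : ℕ → R) {d k : ℤ}
    (h : 1 ≤ k ∨ 1 ≤ k + d) :
    (Entry.ofInt d k).value a b = extendZero a k + extendZero b (k + d) := by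
  unfold Entry.ofInt extendZero
  split_ifs <;> first | omega | simp [Entry.value]

section Tableaux

variable {n : ℕ} {lam mu : Fin n → ℤ}

/-- The filling by integers that corresponds to a tableau. -/
noncomputable def toFilling (T : Box lam mu → Entry) (i : Fin n) (j : ℤ) : ℤ :=
  if h : j ∈ Finset.Ioc (mu i) (lam i) then (T ⟨i, j, h⟩).toInt (j - ((i : ℤ) + 1)) else 0

theorem toFilling_apply (T : Box lam mu → Entry) (b : Box lam mu) :
    toFilling T b.1 b.2.1 = (T b).toInt b.diag :=
  dif_pos b.2.2

theorem mem_tableaux {P Q : Fin n → ℕ} {T : Box lam mu → Entry} :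
    T ∈ tableaux lam mu P Q ↔ (∀ b, T b ∈ entries (P b.1) (Q b.1)) ∧
      (∀ b b' : Box lam mu, b'.IsRightOf b → RowRule (T b) (T b')) ∧
      (∀ b b' : Box lam mu, b'.IsBelow b → ColumnRule (T b) (T b')) ∧
      ∀ b : Box lam mu, DiagonalRule b.diag (T b) := by
  simp only [tableaux, Finset.mem_filter, Fintype.mem_piFinset]

theorem Box.diag_of_isRightOf {b b' : Box lam mu} (h : b'.IsRightOf b) :
    b'.diag = b.diag + 1 := by
  have h1 : ((b'.1 : ℕ) : ℤ) = b.1 := by rw [h.1]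
  have h2 := h.2
  unfold Box.diag
  omega

theorem Box.diag_of_isBelow {b b' : Box lam mu} (h : b'.IsBelow b) : b'.diag = b.diag - 1 := by
  obtain ⟨h1, h2⟩ := h
  unfold Box.diag
  omega

theorem ofInt_toFilling {P Q : Fin n → ℕ} {T : Box lam mu → Entry} (hT : T ∈ tableaux lam mu P Q)
    (b : Box lam mu) : Entry.ofInt b.diag (toFilling T b.1 b.2.1) = T b := by
  obtain ⟨h1, -, -, h4⟩ := mem_tableaux.1 hT
  rw [toFilling_apply]
  exact (Entry.toInt_spec (h1 b) (h4 b)).2.2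

theorem isFilling_toFilling {P Q : Fin n → ℕ} {T : Box lam mu → Entry}
    (hT : T ∈ tableaux lam mu P Q) :
    IsFilling lam mu (fun i => (P i : ℤ)) (toFilling T) := by
  obtain ⟨h1, h2, h3, h4⟩ := mem_tableaux.1 hT
  have hpos : ∀ b : Box lam mu, 1 ≤ toFilling T b.1 b.2.1 ∨ 1 ≤ toFilling T b.1 b.2.1 + b.diag := by
    intro b
    rw [toFilling_apply]
    exact (Entry.toInt_spec (h1 b) (h4 b)).1
  refine ⟨fun i j h => ?_, fun i j hj hj' => ?_, fun i j hj hj' => ?_, fun i j j' hj hjj' hj' => ?_,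
    fun i i' j hi hj hj' hj1 hj1' => ?_⟩
  · exact dif_neg (by rwa [Finset.mem_Ioc])
  · exact hpos ⟨i, j, Finset.mem_Ioc.2 ⟨hj, hj'⟩⟩
  · let b : Box lam mu := ⟨i, j, Finset.mem_Ioc.2 ⟨hj, hj'⟩⟩
    exact (toFilling_apply T b).trans_le (Entry.toInt_spec (h1 b) (h4 b)).2.1
  -- The tableau rule compares adjacent boxes only; chaining it along the row gives the comparison
  -- for all `j ≤ j'`.
  · induction j', hjj' using Int.leInduction with
    | base => rfl
    | succ k hk ih =>
      refine (ih (by omega)).trans ?_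
      let b : Box lam mu := ⟨i, k, Finset.mem_Ioc.2 ⟨by omega, by omega⟩⟩
      let b' : Box lam mu := ⟨i, k + 1, Finset.mem_Ioc.2 ⟨by omega, hj'⟩⟩
      have hb : b'.IsRightOf b := ⟨rfl, rfl⟩
      have h := h2 b b' hb
      have hp := hpos b'
      rw [← ofInt_toFilling hT b, ← ofInt_toFilling hT b', Box.diag_of_isRightOf hb] at h
      rw [Box.diag_of_isRightOf hb] at hp
      exact (rowRule_ofInt (hpos b) hp).1 h
  · let b : Box lam mu := ⟨i, j, Finset.mem_Ioc.2 ⟨hj, hj'⟩⟩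
    let b' : Box lam mu := ⟨i', j, Finset.mem_Ioc.2 ⟨hj1, hj1'⟩⟩
    have hb : b'.IsBelow b := ⟨hi, rfl⟩
    have h := h3 b b' hb
    have hp := hpos b'
    rw [← ofInt_toFilling hT b, ← ofInt_toFilling hT b', Box.diag_of_isBelow hb] at h
    rw [Box.diag_of_isBelow hb] at hp
    exact (columnRule_ofInt (hpos b) hp).1 h

theorem exists_tableau_of_isFilling {P Q : Fin n → ℕ}
    (hPQ : ∀ i, (Q i : ℤ) = P i + (lam i - ((i : ℤ) + 1))) {f : Fin n → ℤ → ℤ}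
    (hf : IsFilling lam mu (fun i => (P i : ℤ)) f) :
    ∃ T ∈ tableaux lam mu P Q, toFilling T = f := by
  have hb : ∀ b : Box lam mu, mu b.1 < b.2.1 ∧ b.2.1 ≤ lam b.1 := fun b => Finset.mem_Ioc.1 b.2.2
  have hpos : ∀ b : Box lam mu, 1 ≤ f b.1 b.2.1 ∨ 1 ≤ f b.1 b.2.1 + b.diag :=
    fun b => hf.pos _ _ (hb b).1 (hb b).2
  have hle : ∀ b : Box lam mu, f b.1 b.2.1 ≤ P b.1 := fun b => hf.le _ _ (hb b).1 (hb b).2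
  -- The primed bound is automatic: `k + j - i ≤ P_i + λ_i - i = Q_i`.
  have hspec : ∀ b : Box lam mu, _ := fun b => Entry.ofInt_spec (Q := Q b.1) (hpos b) (hle b) (by
    have h1 := hle b
    have h2 := (hb b).2
    have h3 := hPQ b.1
    unfold Box.diag
    omega)
  refine ⟨fun b => Entry.ofInt b.diag (f b.1 b.2.1), mem_tableaux.2 ⟨fun b => (hspec b).1, ?_, ?_,
    fun b => (hspec b).2.1⟩, ?_⟩
  · intro b b' h
    have hp := hpos b'
    rw [Box.diag_of_isRightOf h] at hp ⊢
    refine (rowRule_ofInt (hpos b) hp).2 ?_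
    obtain ⟨i, j, hj⟩ := b
    obtain ⟨i', j', hj'⟩ := b'
    obtain ⟨rfl, h2⟩ := h
    exact hf.row _ _ _ (Finset.mem_Ioc.1 hj).1 (h2 ▸ (lt_add_one j).le) (Finset.mem_Ioc.1 hj').2
  · intro b b' h
    have hp := hpos b'
    rw [Box.diag_of_isBelow h] at hp ⊢
    refine (columnRule_ofInt (hpos b) hp).2 ?_
    have h2 := hb b'
    rw [h.2] at h2 ⊢
    exact hf.col _ _ _ h.1 (hb b).1 (hb b).2 h2.1 h2.2
  · ext i j
    by_cases h : j ∈ Finset.Ioc (mu i) (lam i)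
    · rw [toFilling, dif_pos h]
      exact (hspec ⟨i, j, h⟩).2.2
    · rw [toFilling, dif_neg h, hf.off]
      rwa [Finset.mem_Ioc] at h

/-- The tableau formula for flags that satisfy `Q_i = P_i + λ_i - i`. -/
theorem sum_tableaux {R : Type*} [CommRing R] (a b : ℕ → R) {P Q : Fin n → ℕ}
    (hlam : Antitone lam) (hmu : Antitone mu) (hle : ∀ i, mu i ≤ lam i) (hP : Monotone P)
    (hPQ : ∀ i, (Q i : ℤ) = P i + (lam i - ((i : ℤ) + 1))) :
    ∑ T ∈ tableaux lam mu P Q, ∏ c, (T c).value a b =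
      skewSchur (fun i => flagSeries (extendZero a) (extendZero b) (P i) (Q i)) lam mu := by
  classical
  have hS : ∀ f, f ∈ (tableaux lam mu P Q).image toFilling ↔
      IsFilling lam mu (fun i => (P i : ℤ)) f := by
    intro f
    rw [Finset.mem_image]
    refine ⟨?_, exists_tableau_of_isFilling hPQ⟩
    rintro ⟨T, hT, rfl⟩
    exact isFilling_toFilling hT
  have hinj : Set.InjOn toFilling (tableaux lam mu P Q : Set (Box lam mu → Entry)) := by
    intro T hT T' hT' h
    ext1 c
    rw [← ofInt_toFilling hT c, ← ofInt_toFilling hT' c, h]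
  have key := sum_fillingWeight (extendZero_of_nonpos a) (extendZero_of_nonpos b) hlam hmu hle
    (fun i j hij => by exact_mod_cast hP hij) _ hS
  rw [Finset.sum_image hinj] at key
  have hdet : pathDet (extendZero a) (extendZero b) lam mu (fun i => (P i : ℤ)) =
      skewSchur (fun i => flagSeries (extendZero a) (extendZero b) (P i) (Q i)) lam mu := by
    unfold pathDet skewSchur pathSum
    congr 1
    ext k l
    rw [Matrix.of_apply, Matrix.of_apply, ← hPQ k]
    congr 1
    ring
  rw [← hdet, ← key]
  refine Finset.sum_congr rfl fun T hT => ?_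
  rw [fillingWeight, Fintype.prod_sigma]
  refine Finset.prod_congr rfl fun i _ => ?_
  rw [← Finset.prod_coe_sort (Finset.Ioc (mu i) (lam i))]
  refine Finset.prod_congr rfl fun j _ => ?_
  let c : Box lam mu := ⟨i, j⟩
  have hf := isFilling_toFilling hT
  have hj := Finset.mem_Ioc.1 j.2
  have := Entry.value_ofInt a b (hf.pos i j hj.1 hj.2)
  rw [← this]
  exact congrArg _ (ofInt_toFilling hT c).symm

end Tableaux

/-! ### Products over initial parts of alternating words -/

section Words

variable {S : Type*} [CommMonoid S]

theorem list_prod_map_range (f : ℕ → S) (N : ℕ) :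
    ((List.range N).map f).prod = ∏ t ∈ Finset.range N, f t := by
  induction N with
  | zero => simp
  | succ N ih => rw [List.range_succ, Finset.prod_range_succ, ← ih]; simp

theorem prod_getD_append (g : Letter → S) (W W' : List Letter) (d : ℕ → Letter) :
    ∏ t ∈ Finset.range W.length, g ((W ++ W').getD t (d t)) = (W.map g).prod := by
  induction W generalizing d with
  | nil => simp
  | cons a W ih =>
    rw [List.length_cons, Finset.prod_range_succ', List.map_cons, List.prod_cons, mul_comm]
    congr 1
    exact ih fun t => d (t + 1)

/-- The starting counts `m`, `k` are arbitrary so that the induction can pass to the tail of `L`;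
consecutive blocks then merge into intervals. -/
theorem alternating_split (g : Letter → S) (A B : ℕ → Letter) {m' k' : ℕ} (L : List (ℕ × ℕ))
    (hL : L.Pairwise fun e f => e.1 ≤ f.1 ∧ e.2 ≤ f.2) (h : (m', k') ∈ L) (m k : ℕ)
    (hmk : ∀ e ∈ L, m ≤ e.1 ∧ k ≤ e.2) :
    ∃ W W', alternating A B m k L = W ++ W' ∧ W.length = (m' - m) + (k' - k) ∧
      (W.map g).prod =
        (∏ t ∈ Finset.Ico m m', g (A (t + 1))) * ∏ t ∈ Finset.Ico k k', g (B (t + 1)) := by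
  induction L generalizing m k with
  | nil => simp at h
  | cons e L ih =>
    obtain ⟨m₁, k₁⟩ := e
    rw [List.pairwise_cons] at hL
    have hblock : (((List.range (m₁ - m)).map (fun t => A (m + t + 1)) ++
        (List.range (k₁ - k)).map (fun t => B (k + t + 1))).map g).prod =
        (∏ t ∈ Finset.Ico m m₁, g (A (t + 1))) * ∏ t ∈ Finset.Ico k k₁, g (B (t + 1)) := by
      rw [List.map_append, List.prod_append, List.map_map, List.map_map, list_prod_map_range,
        list_prod_map_range, Finset.prod_Ico_eq_prod_range, Finset.prod_Ico_eq_prod_range]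
      rfl
    rw [List.mem_cons] at h
    rcases h with h | h
    · obtain ⟨rfl, rfl⟩ := Prod.mk.inj h
      exact ⟨_, _, rfl, by simp, hblock⟩
    · obtain ⟨W, W', hW, hlen, hprod⟩ := ih hL.2 h m₁ k₁ hL.1
      have h1 := hL.1 _ h
      have h2 := hmk (m₁, k₁) (by simp)
      simp only at h1 h2
      refine ⟨(List.range (m₁ - m)).map (fun t => A (m + t + 1)) ++
        (List.range (k₁ - k)).map (fun t => B (k + t + 1)) ++ W, W',
        by rw [alternating, hW, ← List.append_assoc], ?_, ?_⟩
      · simp only [List.length_append, List.length_map, List.length_range]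
        omega
      · rw [List.map_append, List.prod_append, hblock, hprod, mul_mul_mul_comm,
          Finset.prod_Ico_consecutive _ h2.1 h1.1, Finset.prod_Ico_consecutive _ h2.2 h1.2]

/-- The letters of an alternating word up to the end of a block. -/
theorem prod_alternating (g : Letter → S) (A B : ℕ → Letter) {m k : ℕ} {L : List (ℕ × ℕ)}
    (hL : L.Pairwise fun e f => e.1 ≤ f.1 ∧ e.2 ≤ f.2) (h : (m, k) ∈ L) (d : ℕ → Letter) :
    ∏ t ∈ Finset.range (m + k), g ((alternating A B 0 0 L).getD t (d t)) =
      (∏ t ∈ Finset.range m, g (A (t + 1))) * ∏ t ∈ Finset.range k, g (B (t + 1)) := by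
  obtain ⟨W, W', hW, hlen, hprod⟩ := alternating_split g A B L hL h 0 0 (by simp)
  rw [Nat.sub_zero, Nat.sub_zero] at hlen
  rw [hW, ← hlen, prod_getD_append, hprod, ← Finset.range_eq_Ico, ← Finset.range_eq_Ico]

/-- The first letters of an alternating word. -/
theorem alternating_getD (A B : ℕ → Letter) {L : List (ℕ × ℕ)} {t : ℕ} (h : ∀ e ∈ L, t < e.1) :
    (alternating A B 0 0 L).getD t (A (t + 1)) = A (t + 1) := by
  cases L with
  | nil => simp [alternating]
  | cons e L =>
    obtain ⟨m, k⟩ := e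
    have h1 : t < m := h (m, k) (by simp)
    rw [alternating, List.append_assoc, List.getD_append _ _ _ _ (by simpa using h1)]
    simp [h1]

end Words

/-! ### Divisions, their flags and their letters -/

namespace CompleteTriple

variable {n : ℕ} {τ : CompleteTriple n}

theorem exists_initial_segment (U : Fin n → Prop) :
    ∃ r ≤ n, (∀ i : Fin n, (i : ℕ) < r → U i) ∧ ∀ i : Fin n, (i : ℕ) = r → ¬ U i := by
  classical
  have hr : ∃ r, ∀ i : Fin n, (i : ℕ) = r → ¬ U i := ⟨n, fun i hi => absurd i.2 (by omega)⟩
  refine ⟨Nat.find hr, Nat.find_min' hr fun i hi => absurd i.2 (by omega), fun i hi => ?_,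
    Nat.find_spec hr⟩
  have := Nat.find_min hr hi
  push Not at this
  obtain ⟨j, hj, h⟩ := this
  rwa [Fin.ext hj] at h

/-- Take for the upper rows the longest initial segment with `p ≤ 0 ≤ q`. If all later `p_i` are
positive, the case is (1), and the lower rows begin where `q` stops being positive. Otherwise `p ≤
0` in the first later row by monotonicity, so `q < 0` there and from there on; the case is (2), and
the lower rows begin where `p` stops being negative. -/
theorem nonempty_division (τ : CompleteTriple n) : Nonempty τ.Division := by
  obtain ⟨r, hrn, hr1, hr2⟩ := exists_initial_segment fun i => τ.p i ≤ 0 ∧ 0 ≤ τ.q i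
  by_cases hc : ∀ i : Fin n, r ≤ (i : ℕ) → 0 < τ.p i
  · obtain ⟨s, hsn, hs1, hs2⟩ := exists_initial_segment fun i => (i : ℕ) < r ∨ 0 < τ.q i
    have hrs : r ≤ s := by
      by_contra! h
      exact hs2 ⟨s, by omega⟩ rfl (Or.inl h)
    -- The index `s` found here counts rows from `0`, while the field of the division counts them
    -- from `1`.
    refine ⟨⟨r, s + 1, .nonneg, by omega, by omega, fun i hi => hr1 i (by omega), fun i hi => ?_,
      fun i hi hi' => ?_⟩⟩
    · have h1 := hs2 ⟨s, by omega⟩ rfl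
      have h2 := τ.q_anti (show (⟨s, by omega⟩ : Fin n) ≤ i from Fin.le_def.2 (by simp; omega))
      have h3 := hc i (by omega)
      omega
    · have h1 := hs1 i (by omega)
      have h2 := hc i (by omega)
      simp only
      omega
  · push Not at hc
    obtain ⟨j, hj, hpj⟩ := hc
    have hneg : ∀ i : Fin n, r ≤ (i : ℕ) → τ.q i < 0 := by
      intro i hi
      have h1 := hr2 ⟨r, by omega⟩ rfl
      have h2 := τ.p_mono (show (⟨r, by omega⟩ : Fin n) ≤ j from Fin.le_def.2 hj)
      have h3 := τ.q_anti (show (⟨r, by omega⟩ : Fin n) ≤ i from Fin.le_def.2 hi)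
      omega
    obtain ⟨s, hsn, hs1, hs2⟩ := exists_initial_segment fun i => (i : ℕ) < r ∨ τ.p i < 0
    have hrs : r ≤ s := by
      by_contra! h
      exact hs2 ⟨s, by omega⟩ rfl (Or.inl h)
    refine ⟨⟨r, s + 1, .nonpos, by omega, by omega, fun i hi => hr1 i (by omega), fun i hi => ?_,
      fun i hi hi' => ?_⟩⟩
    · have h1 := hs2 ⟨s, by omega⟩ rfl
      have h2 := τ.p_mono (show (⟨s, by omega⟩ : Fin n) ≤ i from Fin.le_def.2 (by simp; omega))
      have h3 := hneg i (by omega)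
      omega
    · have h1 := hs1 i (by omega)
      have h2 := hneg i (by omega)
      simp only
      omega

end CompleteTriple

namespace CompleteTriple.Division

variable {n : ℕ} {τ : CompleteTriple n} (D : τ.Division) {S : Type*} [CommMonoid S]

theorem mem_upperRows {i : Fin n} : i ∈ D.upperRows ↔ (i : ℕ) + 1 ≤ D.r := by
  simp [upperRows]

theorem mem_lowerRows {i : Fin n} : i ∈ D.lowerRows ↔ D.s ≤ (i : ℕ) + 1 := by
  simp [lowerRows]

theorem pairwise_upperRows : D.upperRows.Pairwise fun i j => j < i := by
  rw [upperRows, List.pairwise_reverse]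
  exact (List.pairwise_lt_finRange n).filter _

theorem pairwise_lowerRows : D.lowerRows.Pairwise fun i j => i < j :=
  (List.pairwise_lt_finRange n).filter _

/-- From a middle to a lower row the flag can only grow, as in case (1) `p_i ≤ p_j ≤ p_j - q_j` and
in case (2) `-q_i ≤ -q_j ≤ p_j - q_j`. -/
theorem plainFlag_mono : Monotone D.plainFlag := by
  intro i j hij
  have hij' : (i : ℕ) ≤ j := hij
  have h1 := τ.p_mono hij
  have h2 := τ.q_anti hij
  have h3 := D.lower j
  have h4 := D.middle i
  have h5 := D.r_lt_s
  unfold plainFlag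
  cases hs : D.sign <;> simp only [hs] at h4 ⊢ <;> split_ifs <;> omega

theorem primedFlag_eq (i : Fin n) :
    (D.primedFlag i : ℤ) = D.plainFlag i + (τ.shape i - ((i : ℤ) + 1)) := by
  have h1 := D.upper i
  have h3 := D.lower i
  have h4 := D.middle i
  unfold plainFlag primedFlag shape
  cases hs : D.sign <;> simp only [hs] at h4 ⊢ <;> split_ifs <;> omega

/-- For an upper row, the flag ends exactly at the end of that row's block of the word. For a middle
row, all its letters lie in the first run of the word, since the upper rows have larger `q` (or
`-p`); if there are no upper rows, the default letters take over. A lower row uses no letters. -/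
theorem prod_vLetter (g : Letter → S) (i : Fin n) :
    ∏ t ∈ Finset.range (D.primedFlag i), g (D.vLetter (t + 1)) =
      (∏ t ∈ Finset.range (-τ.p i).toNat, g (.xt (t + 1))) *
        ∏ t ∈ Finset.range (τ.q i).toNat, g (.y (t + 1)) := by
  have hp := D.pairwise_upperRows
  by_cases hr : (i : ℕ) + 1 ≤ D.r
  · have h1 := D.upper i hr
    have hmem := D.mem_upperRows.2 hr
    unfold primedFlag vLetter vWord
    rw [if_pos hr]
    cases D.sign
    · rw [show (τ.q i - τ.p i).toNat = (τ.q i).toNat + (-τ.p i).toNat by omega, mul_comm]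
      refine prod_alternating g .y .xt (List.pairwise_map.2 (hp.imp ?_))
        (List.mem_map_of_mem hmem) fun t => .y (t + 1)
      intro a b hab
      have h2 := τ.p_mono hab.le
      have h3 := τ.q_anti hab.le
      simp only
      omega
    · rw [show (τ.q i - τ.p i).toNat = (-τ.p i).toNat + (τ.q i).toNat by omega]
      refine prod_alternating g .xt .y (List.pairwise_map.2 (hp.imp ?_))
        (List.mem_map_of_mem hmem) fun t => .xt (t + 1)
      intro a b hab
      have h2 := τ.p_mono hab.le
      have h3 := τ.q_anti hab.le
      simp only
      omega
  by_cases hs : D.s ≤ (i : ℕ) + 1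
  · have h1 := D.lower i hs
    unfold primedFlag
    rw [if_neg hr, if_pos hs, show (-τ.p i).toNat = 0 by omega, show (τ.q i).toNat = 0 by omega]
    simp
  have hm := D.middle i (by omega) (by omega)
  have hlt : ∀ j ∈ D.upperRows, j < i := fun j hj =>
    Fin.lt_def.2 (by have := D.mem_upperRows.1 hj; omega)
  unfold primedFlag vLetter vWord
  rw [if_neg hr, if_neg hs]
  cases hsign : D.sign <;> simp only [hsign] at hm ⊢
  · rw [show (-τ.p i).toNat = 0 by omega, Finset.prod_range_zero, one_mul]
    refine Finset.prod_congr rfl fun t ht => congrArg g (alternating_getD .y .xt ?_)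
    intro e he
    obtain ⟨j, hj, rfl⟩ := List.mem_map.1 he
    have := τ.q_anti (hlt j hj).le
    rw [Finset.mem_range] at ht
    simp only
    omega
  · rw [show (τ.q i).toNat = 0 by omega, Finset.prod_range_zero, mul_one]
    refine Finset.prod_congr rfl fun t ht => congrArg g (alternating_getD .xt .y ?_)
    intro e he
    obtain ⟨j, hj, rfl⟩ := List.mem_map.1 he
    have := τ.p_mono (hlt j hj).le
    rw [Finset.mem_range] at ht
    simp only
    omega

theorem prod_uLetter (g : Letter → S) (i : Fin n) :
    ∏ t ∈ Finset.range (D.plainFlag i), g (D.uLetter (t + 1)) =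
      (∏ t ∈ Finset.range (τ.p i).toNat, g (.x (t + 1))) *
        ∏ t ∈ Finset.range (-τ.q i).toNat, g (.yt (t + 1)) := by
  have hp := D.pairwise_lowerRows
  have hrs := D.r_lt_s
  by_cases hr : (i : ℕ) + 1 ≤ D.r
  · have h1 := D.upper i hr
    unfold plainFlag
    rw [if_pos hr, show (τ.p i).toNat = 0 by omega, show (-τ.q i).toNat = 0 by omega]
    simp
  by_cases hs : D.s ≤ (i : ℕ) + 1
  · have h1 := D.lower i hs
    have hmem := D.mem_lowerRows.2 hs
    unfold plainFlag uLetter uWord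
    rw [if_neg hr, if_pos hs]
    cases D.sign
    · rw [show (τ.p i - τ.q i).toNat = (τ.p i).toNat + (-τ.q i).toNat by omega]
      refine prod_alternating g .x .yt (List.pairwise_map.2 (hp.imp ?_))
        (List.mem_map_of_mem hmem) fun t => .x (t + 1)
      intro a b hab
      have h2 := τ.p_mono hab.le
      have h3 := τ.q_anti hab.le
      simp only
      omega
    · rw [show (τ.p i - τ.q i).toNat = (-τ.q i).toNat + (τ.p i).toNat by omega, mul_comm]
      refine prod_alternating g .yt .x (List.pairwise_map.2 (hp.imp ?_))
        (List.mem_map_of_mem hmem) fun t => .yt (t + 1)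
      intro a b hab
      have h2 := τ.p_mono hab.le
      have h3 := τ.q_anti hab.le
      simp only
      omega
  have hm := D.middle i (by omega) (by omega)
  have hlt : ∀ j ∈ D.lowerRows, i < j := fun j hj =>
    Fin.lt_def.2 (by have := D.mem_lowerRows.1 hj; omega)
  unfold plainFlag uLetter uWord
  rw [if_neg hr, if_neg hs]
  cases hsign : D.sign <;> simp only [hsign] at hm ⊢
  · rw [show (-τ.q i).toNat = 0 by omega, Finset.prod_range_zero, mul_one]
    refine Finset.prod_congr rfl fun t ht => congrArg g (alternating_getD .x .yt ?_)
    intro e he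
    obtain ⟨j, hj, rfl⟩ := List.mem_map.1 he
    have := τ.p_mono (hlt j hj).le
    rw [Finset.mem_range] at ht
    simp only
    omega
  · rw [show (τ.p i).toNat = 0 by omega, Finset.prod_range_zero, one_mul]
    refine Finset.prod_congr rfl fun t ht => congrArg g (alternating_getD .yt .x ?_)
    intro e he
    obtain ⟨j, hj, rfl⟩ := List.mem_map.1 he
    have := τ.q_anti (hlt j hj).le
    rw [Finset.mem_range] at ht
    simp only
    omega

end CompleteTriple.Division

/-! ### Chern series as flag series -/

section Chern

open PowerSeries

variable {R : Type*} [CommRing R]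

theorem prod_Icc_one (g : ℤ → PowerSeries R) (m : ℤ) :
    ∏ k ∈ Finset.Icc 1 m, g k = ∏ t ∈ Finset.range m.toNat, g ((t + 1 : ℕ) : ℤ) := by
  refine Finset.prod_bij' (fun k _ => (k - 1).toNat) (fun t _ => ((t + 1 : ℕ) : ℤ)) ?_ ?_ ?_ ?_ ?_
  · intro k hk
    rw [Finset.mem_Icc] at hk
    rw [Finset.mem_range]
    omega
  · intro t ht
    rw [Finset.mem_range] at ht
    rw [Finset.mem_Icc]
    omega
  · intro k hk
    rw [Finset.mem_Icc] at hk
    omega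
  · intro t ht
    omega
  · intro k hk
    rw [Finset.mem_Icc] at hk
    congr 1
    omega

theorem prod_Icc_zero (g : ℤ → PowerSeries R) (m : ℤ) :
    ∏ k ∈ Finset.Icc (m + 1) 0, g k =
      ∏ t ∈ Finset.range (-m).toNat, g (1 - ((t + 1 : ℕ) : ℤ)) := by
  rw [← prod_Icc_one fun k => g (1 - k)]
  refine Finset.prod_bij' (fun k _ => 1 - k) (fun k _ => 1 - k) ?_ ?_ ?_ ?_ ?_ <;> intro k hk <;>
    rw [Finset.mem_Icc] at * <;> first | omega | ring_nf

/-- The sign and index shift in `x̃_k = -x_{1-k}` turn the factors `1 - x_j t`, `j ≤ 0`, into the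
form `1 + v t`. -/
theorem chernNum_eq (x y : ℤ → R) (p q : ℤ) :
    chernNum x y p q =
      (∏ t ∈ Finset.range (-p).toNat, (1 + C (letterValue x y (.xt (t + 1))) * X)) *
        ∏ t ∈ Finset.range q.toNat, (1 + C (letterValue x y (.y (t + 1))) * X) := by
  rw [chernNum, prod_Icc_one, prod_Icc_zero]
  simp only [letterValue, map_neg, neg_mul, sub_eq_add_neg]

theorem chernDen_eq (x y : ℤ → R) (p q : ℤ) :
    chernDen x y p q =
      (∏ t ∈ Finset.range p.toNat, (1 - C (letterValue x y (.x (t + 1))) * X)) *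
        ∏ t ∈ Finset.range (-q).toNat, (1 - C (letterValue x y (.yt (t + 1))) * X) := by
  rw [chernDen, prod_Icc_one, prod_Icc_zero]
  simp only [letterValue, map_neg, neg_mul, sub_neg_eq_add]

theorem CompleteTriple.Division.flagSeries_eq_chern {n : ℕ} {τ : CompleteTriple n}
    (D : τ.Division) (x y : ℤ → R) (i : Fin n) :
    flagSeries (extendZero fun k => letterValue x y (D.uLetter k))
      (extendZero fun l => letterValue x y (D.vLetter l)) (D.plainFlag i) (D.primedFlag i) =
      τ.chern x y i := by
  have h : ∀ (a : ℕ → R) (t : ℕ), extendZero a ((t + 1 : ℕ) : ℤ) = a (t + 1) := fun a t => by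
    rw [extendZero_of_pos _ (by omega), Int.toNat_natCast]
  rw [flagSeries, CompleteTriple.chern, chernSeries, chernNum_eq, chernDen_eq, prod_Icc_one,
    prod_Icc_one, Int.toNat_natCast, Int.toNat_natCast,
    ← D.prod_vLetter fun a => 1 + C (letterValue x y a) * X,
    ← D.prod_uLetter fun a => 1 - C (letterValue x y a) * X]
  simp only [h]

end Chern

/-! ### The tableau formula and the expansion in `S_μ(c)` -/

section Main

variable {R : Type*} [CommRing R] {n : ℕ}

/-- The tableau formula for the determinants of a complete triple. -/
theorem CompleteTriple.Division.skewSchur_chern {τ : CompleteTriple n} (D : τ.Division)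
    (x y : ℤ → R) {mu : Fin n → ℤ} (hmu : Antitone mu) (hle : ∀ i, mu i ≤ τ.shape i) :
    skewSchur (τ.chern x y) τ.shape mu =
      MvPolynomial.aeval (letterValue x y) (D.tableauSum mu) := by
  have h := sum_tableaux (fun k => letterValue x y (D.uLetter k))
    (fun l => letterValue x y (D.vLetter l)) τ.l_anti hmu hle D.plainFlag_mono D.primedFlag_eq
  simp only [D.flagSeries_eq_chern] at h
  refine h.symm.trans ?_
  unfold tableauSum
  rw [map_sum]
  refine Finset.sum_congr rfl fun T _ => ?_
  rw [map_prod]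
  refine Finset.prod_congr rfl fun b _ => ?_
  cases T b <;> simp [entryWeight, Entry.value]

theorem skewSchur_eq_zero_of_lt (f : Fin n → PowerSeries R) {lam mu : Fin n → ℤ}
    (hlam : Antitone lam) (hmu : Antitone mu) (i : Fin n) (h : lam i < mu i) :
    skewSchur f lam mu = 0 := by
  refine det_eq_zero_of_zero_block _ i fun k l hk hl => intCoeff_of_neg _ ?_
  have h1 := hlam hk
  have h2 := hmu hl
  have h3 : (i : ℤ) ≤ k := by exact_mod_cast hk
  have h4 : (l : ℤ) ≤ i := by exact_mod_cast hl
  omega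

/-- A strictly decreasing integer sequence drops by at least one at each step, so `g_j + j` is
weakly decreasing; this recovers `μ` from the indices in Cauchy–Binet. -/
theorem strictAnti_add_le {g : Fin n → ℤ} (hg : StrictAnti g) {i j : Fin n} (hij : i ≤ j) :
    g j + ((j : ℤ) - i) ≤ g i := by
  obtain ⟨d, hd⟩ : ∃ d : ℕ, (j : ℕ) = i + d := ⟨j - i, by have := Fin.le_def.1 hij; omega⟩
  clear hij
  induction d generalizing j with
  | zero =>
    obtain rfl : j = i := Fin.ext hd
    simp
  | succ d ih =>
    have h1 := ih (j := ⟨i + d, by omega⟩) rfl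
    have h2 := hg (show (⟨i + d, by omega⟩ : Fin n) < j from Fin.lt_def.2 (by simp; omega))
    simp only at h1
    omega

/-- The expansion of `S_λ(f(1) c, …, f(n) c)` in terms of the `S_μ(c)`. -/
theorem schur_mul (f : Fin n → PowerSeries R) (c : PowerSeries R) {lam : Fin n → ℤ}
    (hlam : Antitone lam) (hpos : ∀ i, 0 ≤ lam i) :
    schur (fun i => f i * c) lam =
      ∑ mu ∈ subpartitions lam, skewSchur f lam mu * schur (fun _ : Fin n => c) mu := by
  classical
  -- The interval `[-n, B]` contains every `μ_j - j` with `0 ≤ μ_j ≤ λ_j`, and every `z` at which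
  -- some summand is nonzero.
  set B : ℤ := ∑ i, lam i
  have hB : ∀ i, lam i ≤ B := fun i =>
    Finset.single_le_sum (f := lam) (fun j _ => hpos j) (Finset.mem_univ i)
  have hdet : schur (fun i => f i * c) lam = Matrix.det (Matrix.of fun k l : Fin n =>
      ∑ z ∈ Finset.Icc (-(n : ℤ)) B, intCoeff (f k) (lam k - k - z) * intCoeff c (z + l)) := by
    unfold schur skewSchur
    congr 1
    ext k l
    rw [Matrix.of_apply, Matrix.of_apply, ← intCoeff_mul _ _ _ _ _ _ (by omega)
      (by have := hB k; omega)]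
    congr 1
    simp only [Pi.zero_apply]
    ring
  rw [hdet, det_sum_mul (Finset.Icc (-(n : ℤ)) B) (fun k z => intCoeff (f k) (lam k - k - z))
    (fun z l => intCoeff c (z + l))]
  symm
  have hterm : ∀ mu : Fin n → ℤ, skewSchur f lam mu * schur (fun _ : Fin n => c) mu =
      Matrix.det (Matrix.of fun k j : Fin n => intCoeff (f k) (lam k - k - (mu j - j))) *
        Matrix.det (Matrix.of fun j l : Fin n => intCoeff c (mu j - j + l)) := by
    intro mu
    unfold schur skewSchur
    congr 2 <;> ext k l <;> simp only [Matrix.of_apply, Pi.zero_apply] <;> congr 1 <;> ring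
  -- The map `μ ↦ (μ_j - j)` embeds the subpartitions into the strictly decreasing sequences; what
  -- remains is that sequences outside its image contribute zero.
  refine Finset.sum_of_injOn (fun mu j => mu j - (j : ℤ)) ?_ ?_ ?_ fun mu _ => hterm mu
  · intro mu _ nu _ h
    ext j
    have := congrFun h j
    simp only at this
    omega
  · intro mu hmu
    simp only [subpartitions, Finset.coe_filter, Fintype.mem_piFinset, Finset.mem_Icc,
      Set.mem_ofPred_eq] at hmu ⊢
    refine ⟨fun j => ?_, fun i j hij => ?_⟩
    · have h1 := hmu.1 j
      have h2 := hB j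
      omega
    · have h1 := hmu.2 hij.le
      have h2 := Fin.lt_def.1 hij
      simp only
      omega
  · intro g hg hnot
    rw [Finset.mem_filter] at hg
    have hanti : Antitone fun j : Fin n => g j + (j : ℤ) := fun i j hij => by
      have := strictAnti_add_le hg.2 hij
      simp only
      omega
    have hg' : g = fun j : Fin n => (g j + (j : ℤ)) - j := by
      ext j
      ring
    have hprod := hterm fun j : Fin n => g j + (j : ℤ)
    simp only [add_sub_cancel_right] at hprod
    rw [← hprod]
    -- A sequence outside the image has `μ_i > λ_i` for some `i`, which kills the first determinant,
    -- or `μ_i < 0`, which kills the second as a skew determinant of shape `μ/0`.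
    by_cases h1 : ∃ i, lam i < g i + i
    · obtain ⟨i, hi⟩ := h1
      rw [skewSchur_eq_zero_of_lt f hlam hanti i hi, zero_mul]
    by_cases h2 : ∃ i, g i + (i : ℤ) < 0
    · obtain ⟨i, hi⟩ := h2
      rw [schur, skewSchur_eq_zero_of_lt _ hanti (fun _ _ _ => le_rfl) i hi, mul_zero]
    push Not at h1 h2
    refine absurd ⟨fun j : Fin n => g j + (j : ℤ), ?_, hg'.symm⟩ hnot
    simp only [subpartitions, Finset.coe_filter, Fintype.mem_piFinset, Finset.mem_Icc,
      Set.mem_ofPred_eq]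
    exact ⟨fun j => ⟨h2 j, h1 j⟩, hanti⟩

end Main

end Vexillary

theorem mainTheorem5 {n : ℕ} (τ : Vexillary.CompleteTriple n) :
    Nonempty τ.Division ∧
    ∀ (D : τ.Division) {R : Type*} [CommRing R] (x y : ℤ → R),
      (∀ mu : Fin n → ℤ, Antitone mu → (∀ i, mu i ≤ τ.shape i) →
        Vexillary.skewSchur (τ.chern x y) τ.shape mu =
          MvPolynomial.aeval (Vexillary.letterValue x y) (D.tableauSum mu)) ∧
      ∀ c : PowerSeries R, PowerSeries.constantCoeff c = 1 →
        τ.enriched c x y =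
          ∑ mu ∈ Vexillary.subpartitions τ.shape,
            MvPolynomial.aeval (Vexillary.letterValue x y) (D.tableauSum mu) *
              Vexillary.schur (fun _ : Fin n => c) mu := by
  refine ⟨τ.nonempty_division, fun D R _ x y => ⟨fun mu hmu hle => D.skewSchur_chern x y hmu hle,
    fun c _ => ?_⟩⟩
  refine (Vexillary.schur_mul _ c τ.l_anti fun i => (τ.l_pos i).le).trans ?_
  refine Finset.sum_congr rfl fun mu hmu => ?_
  simp only [Vexillary.subpartitions, Finset.mem_filter, Fintype.mem_piFinset,
    Finset.mem_Icc] at hmu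
  rw [← D.skewSchur_chern x y hmu.2 fun i => (hmu.1 i).2]
  rfl
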